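/- Let $q>2$ be a prime power, let $A=\mathbb{F}_q[T]$, and let $C$ be the Carlitz module, i.e. the $\mathbb{F}_q$-algebra homomorphism $a\mapsto C_a$ from $A$ to the twisted polynomials in $\tau$ ($\tau(x)=x^q$) with $C_T=T+\tau$; for $m,u\in A$ write $C_m(u)\in A$ for the value of $C_m$ at $u$ (so $C_T(u)=Tu+u^q$). For monic $u,m\in A$, a monic prime $\wp\in A$ is a \emph{Zsigmondy prime} for $(u,m)$ if $\wp\mid C_m(u)$ and $\wp\nmid C_n(u)$ for every nonzero $n\in A$ with $\deg n<\deg m$; it is a \emph{large Zsigmondy prime} for $(u,m)$ if in addition $\deg\wp>\deg m$ or $\wp^2\mid C_m(u)$. \textbf{Theorem.} Let $u,m\in A$ be monic, at least one of them of positive degree. Then there exists a large Zsigmondy prime for $(u,m)$, except exactly in the following cases: (EC-I) $q=3$, $u=1$, and $m=(\wp-1)\wp$ for a monic prime $\wp$ of degree one; (EC-II) $q=4$, $u=1$, and $m=(\wp-1)\wp$ for a monic prime $\wp$ of degree one; (EC-III) $q=3$, $u=1$, and $m\in\{(T-1)T^2,\ T(T+1)^2,\ (T+1)(T+2)^2\}$;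 (EC-IV) $q=3$ and $u=m\in\{T,\ T+1,\ T+2\}$; (EC-V) $q=5$, $u=1$, and $m\in\{T(T+1),\ (T+1)(T+2),\ (T+2)(T+3),\ (T+3)(T+4),\ (T+4)T\}$; (EC-VI) $u=1$ and $m$ is a monic prime of degree one (any $q>2$); (EC-VII) $q=3$, $u=1$, and $m\in\{T^2,\ (T+1)^2,\ (T+2)^2\}$; (EC-VIII) $q=4$, $u=1$, and $m\in\{T(T+w),\ T(T+w^2),\ (T+1)(T+w),\ (T+1)(T+w^2)\}$, where $w\in\mathbb{F}_4$ satisfies $w^2+w+1=0$; (EC-IX) $q=3$, $u=1$, and $m=T^3+2T$. -/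

import Mathlib

open Polynomial

section CarlitzZsigmondy

/-- The `𝔽_q`-linear endomorphism `T + τ` of `A = 𝔽_q[T]`, that is `x ↦ T * x + x ^ q`,
where `q` is the number of elements of `F`. -/
noncomputable def carlitzT (F : Type*) [Field F] [Fintype F] : Module.End F F[X] :=
  LinearMap.mulLeft F (X : F[X]) + (FiniteField.frobeniusAlgHom F F[X]).toLinearMap

theorem carlitzT_apply (F : Type*) [Field F] [Fintype F] (x : F[X]) :
    carlitzT F x = X * x + x ^ Fintype.card F := by
  simp [carlitzT]

/-- The Carlitz module, as an action on `A = 𝔽_q[T]`: the unique `𝔽_q`-algebra homomorphism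
`a ↦ C_a` with `C_T = T + τ`. The value `C_m(u)` is `carlitz F m u`. Twisted polynomials in `τ`
with coefficients in `A` are represented here by the (faithful) action on `A`, in which `τ` is
`x ↦ x ^ q` and coefficients act by multiplication. -/
noncomputable def carlitz (F : Type*) [Field F] [Fintype F] : F[X] →ₐ[F] Module.End F F[X] :=
  aeval (carlitzT F)

theorem carlitz_X (F : Type*) [Field F] [Fintype F] : carlitz F X = carlitzT F := by
  simp [carlitz]

/-- The monic prime `P` is a Zsigmondy prime for `(u, m)`: it divides `C_m(u)`, and it does not
divide `C_n(u)` for any nonzero `n` of degree less than that of `m`. -/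
def IsZsigmondyPrime {F : Type*} [Field F] [Fintype F] (u m P : F[X]) : Prop :=
  P.Monic ∧ Prime P ∧ P ∣ carlitz F m u ∧
    ∀ n : F[X], n ≠ 0 → n.degree < m.degree → ¬ P ∣ carlitz F n u

/-- A Zsigmondy prime `P` for `(u, m)` is large if `deg P > deg m` or `P ^ 2 ∣ C_m(u)`. -/
def IsLargeZsigmondyPrime {F : Type*} [Field F] [Fintype F] (u m P : F[X]) : Prop :=
  IsZsigmondyPrime u m P ∧ (m.degree < P.degree ∨ P ^ 2 ∣ carlitz F m u)

/-- The nine families of exceptional pairs `(u, m)` over the field `F` with `q` elements, in the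
order (EC-I), ..., (EC-IX). -/
def IsFeitException {F : Type*} [Field F] [Fintype F] (u m : F[X]) : Prop :=
  (Fintype.card F = 3 ∧ u = 1 ∧
    ∃ P : F[X], P.Monic ∧ Prime P ∧ P.degree = 1 ∧ m = (P - 1) * P) ∨
  (Fintype.card F = 4 ∧ u = 1 ∧
    ∃ P : F[X], P.Monic ∧ Prime P ∧ P.degree = 1 ∧ m = (P - 1) * P) ∨
  (Fintype.card F = 3 ∧ u = 1 ∧
    (m = (X - 1) * X ^ 2 ∨ m = X * (X + 1) ^ 2 ∨ m = (X + 1) * (X + 2) ^ 2)) ∨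
  (Fintype.card F = 3 ∧ u = m ∧ (m = X ∨ m = X + 1 ∨ m = X + 2)) ∨
  (Fintype.card F = 5 ∧ u = 1 ∧
    (m = X * (X + 1) ∨ m = (X + 1) * (X + 2) ∨ m = (X + 2) * (X + 3) ∨
      m = (X + 3) * (X + 4) ∨ m = (X + 4) * X)) ∨
  (u = 1 ∧ m.Monic ∧ Prime m ∧ m.degree = 1) ∨
  (Fintype.card F = 3 ∧ u = 1 ∧ (m = X ^ 2 ∨ m = (X + 1) ^ 2 ∨ m = (X + 2) ^ 2)) ∨
  (Fintype.card F = 4 ∧ u = 1 ∧ ∃ w : F, w ^ 2 + w + 1 = 0 ∧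
    (m = X * (X + C w) ∨ m = X * (X + C (w ^ 2)) ∨
      m = (X + 1) * (X + C w) ∨ m = (X + 1) * (X + C (w ^ 2)))) ∨
  (Fintype.card F = 3 ∧ u = 1 ∧ m = X ^ 3 + 2 * X)

end CarlitzZsigmondy

/-!
# Large Zsigmondy primes for the Carlitz module

Let `m₀` be the order of `u` modulo a prime `P`, so that `P ∣ C_a(u)` if and only if `m₀ ∣ a`. As
`C_P` reduces to the Frobenius modulo `P` (`dvd_carlitz_self_sub`), `m₀` divides `P - 1`. For
`q > 2` the valuation of `C_a(x)` at a prime divisor of `x` is the sum of those of `a` and `x`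
(`multiplicity_carlitz`). Therefore the primitive part `∏ C_{m / d}(u) ^ μ(d)` of `C_m(u)` has at
`P` the valuation of `C_m(u)` if `P` is a Zsigmondy prime, the valuation `1` if `m = m₀ * P ^ k`
with `k ≥ 1` (then `P` is called intrinsic), and the valuation `0` otherwise
(`altSum_multiplicity`).

A Zsigmondy prime `P` satisfies `m ∣ P - 1`, so one that is not large is equal to `m + 1` and
divides `C_m(u)` just once. If no Zsigmondy prime is large, the degree of the primitive part is
therefore at most that of `m + 1` times the intrinsic primes, hence at most `2 * deg m`. On the
other hand that degree is `φ(m) * deg u`, or about `φ(m) / q` if `u = 1`, and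
`φ(m) ≥ (q - 1) ^ deg m`. This bound (`totient_bound`) leaves `q = 3` and `deg m ≤ 2` if `u` has
positive degree; if `u = 1`, it leaves `deg m = 1`, or `deg m = 2` and `q ≤ 5`, or `q = 3` and
`deg m ≤ 4`. Sharper lower bounds for `φ(m)` in terms of the factorization of `m`
(`IsRadicalDecomposition.mul_pow_le_totient`) reduce these to the exceptional pairs.

Conversely, in each exceptional case `C_m(u)` divides the product of `m + 1` and values `C_n(u)`
with `deg n < deg m`, by an explicit polynomial identity, and this rules out a large Zsigmondy prime
(`not_exists_isLargeZsigmondyPrime`).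
-/

/-! ### Reduction of the Carlitz module modulo a prime -/

section Reduction

variable {F : Type*} [Field F]

/-- Precomposition with `c`, as a linear map for the action of `k` on the values. -/
def precompEnd {k : Type*} [Field k] [Algebra F k] (c : Module.End F k) :
    Module.End k (k →ₗ[F] k) where
  toFun φ := φ.comp c
  map_add' _ _ := rfl
  map_smul' _ _ := rfl

theorem aeval_precompEnd {k : Type*} [Field k] [Algebra F k] (c : Module.End F k) (a : F[X])
    (φ : k →ₗ[F] k) : aeval (precompEnd c) a φ = φ.comp (aeval c a) := by
  induction a using Polynomial.induction_on' generalizing φ with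
  | add p q hp hq => simp [hp, hq, LinearMap.comp_add]
  | monomial n r =>
    induction n generalizing φ with
    | zero => ext x; simp [Algebra.algebraMap_eq_smul_one]
    | succ n ih =>
      have h1 : (monomial (n + 1) r : F[X]) = X * monomial n r := by
        simp [X_mul_monomial]
      have h2 : (monomial (n + 1) r : F[X]) = monomial n r * X := by
        simp [monomial_mul_X]
      have h3 : aeval c (monomial (n + 1) r : F[X]) = aeval c (monomial n r : F[X]) * c := by
        rw [h2, map_mul, aeval_X]
      rw [h3, h1, map_mul, aeval_X, Module.End.mul_apply, ih]
      rfl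

variable [Fintype F]

/-- Let `c = t + τ` on `k`. The left action of `k` and precomposition with `c` commute, and
`τ ^ (i + 1) = τ ^ i * c - t ^ (q ^ i) * τ ^ i`. Hence the product of the `c - t ^ (q ^ j)` with
`j < i`, where `c` acts on the right and `t ^ (q ^ j)` on the left, is `τ ^ i`. -/
theorem precompEnd_prod_eq_pow {k : Type*} [Field k] [Algebra F k] (t : k) (i : ℕ) (x : k) :
    aeval (precompEnd (LinearMap.mulLeft F t + (FiniteField.frobeniusAlgHom F k).toLinearMap))
      (∏ j ∈ Finset.range i, (X - C (t ^ Fintype.card F ^ j)) : k[X]) LinearMap.id x =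
      x ^ Fintype.card F ^ i := by
  induction i generalizing x with
  | zero => simp
  | succ i ih =>
    rw [Finset.prod_range_succ, mul_comm, map_mul, Module.End.mul_apply]
    set φ := aeval (precompEnd (LinearMap.mulLeft F t +
      (FiniteField.frobeniusAlgHom F k).toLinearMap))
      (∏ j ∈ Finset.range i, (X - C (t ^ Fintype.card F ^ j)) : k[X]) LinearMap.id
    rw [map_sub, aeval_X, aeval_C, LinearMap.sub_apply, LinearMap.sub_apply,
      Module.algebraMap_end_apply, LinearMap.smul_apply, ih]
    change φ (t * x + x ^ Fintype.card F) - _ = _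
    rw [map_add, ih, ih, mul_pow, smul_eq_mul, ← pow_mul, pow_succ']
    ring

/-- An irreducible polynomial over a finite field splits in the field it generates, its roots being
the iterated Frobenius images of the adjoined root. -/
theorem AdjoinRoot.map_eq_prod_X_sub_C_pow {P : F[X]} [Fact (Irreducible P)] (hP : P.Monic) :
    P.map (algebraMap F (AdjoinRoot P)) =
      ∏ j ∈ Finset.range P.natDegree,
        (X - C (AdjoinRoot.root P ^ Fintype.card F ^ j) : (AdjoinRoot P)[X]) := by
  have hP0 := hP.ne_zero
  let pb := AdjoinRoot.powerBasis hP0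
  have : Module.Finite F (AdjoinRoot P) := pb.finite
  have : Finite (AdjoinRoot P) := Module.finite_of_finite F
  have hfin : Module.finrank F (AdjoinRoot P) = P.natDegree := by
    rw [pb.finrank, AdjoinRoot.powerBasis_dim]
  have hpow (j : ℕ) : (FiniteField.frobeniusAlgHom F (AdjoinRoot P) ^ j) (AdjoinRoot.root P) =
      AdjoinRoot.root P ^ Fintype.card F ^ j := by
    rw [AlgHom.coe_pow, FiniteField.coe_frobeniusAlgHom, pow_iterate]
  have hinj : Set.InjOn (fun j ↦ AdjoinRoot.root P ^ Fintype.card F ^ j)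
      (Finset.range P.natDegree : Set ℕ) := by
    intro i hi j hj hij
    simp only [Finset.coe_range, Set.mem_Iio] at hi hj
    have h := (FiniteField.bijective_frobeniusAlgHom_pow F (AdjoinRoot P)).1
      (a₁ := ⟨i, hfin ▸ hi⟩) (a₂ := ⟨j, hfin ▸ hj⟩)
      (by
        refine AdjoinRoot.algHom_ext ?_
        simpa only [hpow] using hij)
    simpa using h
  have hdvd : (∏ j ∈ Finset.range P.natDegree,
      (X - C (AdjoinRoot.root P ^ Fintype.card F ^ j) : (AdjoinRoot P)[X])) ∣
      P.map (algebraMap F (AdjoinRoot P)) := by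
    refine Finset.prod_dvd_of_coprime (fun i hi j hj hij ↦ ?_) fun j _ ↦ ?_
    · exact isCoprime_X_sub_C_of_isUnit_sub
        (sub_ne_zero.2 fun h ↦ hij (hinj hi hj h)).isUnit
    · rw [dvd_iff_isRoot, IsRoot, eval_map_algebraMap, ← hpow, aeval_algHom_apply,
        AdjoinRoot.aeval_eq, AdjoinRoot.mk_self, map_zero]
  refine eq_of_monic_of_dvd_of_natDegree_le (monic_prod_of_monic _ _ fun j _ ↦ monic_X_sub_C _)
    (hP.map _) hdvd ?_
  rw [natDegree_map, natDegree_prod_of_monic _ _ fun j _ ↦ monic_X_sub_C _]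
  simp only [natDegree_X_sub_C]
  simp

/-- The reduction modulo `P` intertwines `C_a` with the same polynomial in `t + τ`, where `t` is the
class of `T`. -/
theorem mk_carlitz (P a x : F[X]) :
    AdjoinRoot.mk P (carlitz F a x) =
      aeval (LinearMap.mulLeft F (AdjoinRoot.root P) +
        (FiniteField.frobeniusAlgHom F (AdjoinRoot P)).toLinearMap) a (AdjoinRoot.mk P x) := by
  induction a using Polynomial.induction_on' generalizing x with
  | add p q hp hq => simp [hp, hq]
  | monomial n r =>
    induction n generalizing x with
    | zero => simp [Algebra.algebraMap_eq_smul_one, carlitz, AdjoinRoot.smul_mk]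
    | succ n ih =>
      rw [← monomial_mul_X, map_mul, map_mul, Module.End.mul_apply, Module.End.mul_apply, ih,
        carlitz_X, carlitzT_apply, aeval_X]
      simp

/-- The Carlitz module reduces to the Frobenius: `C_P` acts on `A / P` as `x ↦ x ^ |P|`, that is,
as the identity. -/
theorem dvd_carlitz_self_sub {P : F[X]} (hP : P.Monic) (hirr : Irreducible P) (x : F[X]) :
    P ∣ carlitz F P x - x := by
  have := Fact.mk hirr
  have hP0 := hP.ne_zero
  let pb := AdjoinRoot.powerBasis hP0
  have : Module.Finite F (AdjoinRoot P) := pb.finite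
  have : Finite (AdjoinRoot P) := Module.finite_of_finite F
  have : Fintype (AdjoinRoot P) := Fintype.ofFinite _
  have hcard : Fintype.card (AdjoinRoot P) = Fintype.card F ^ P.natDegree := by
    rw [Module.card_eq_pow_finrank (K := F), pb.finrank, AdjoinRoot.powerBasis_dim]
  rw [← AdjoinRoot.mk_eq_zero, map_sub, sub_eq_zero, mk_carlitz]
  have h := precompEnd_prod_eq_pow (F := F) (AdjoinRoot.root P) P.natDegree (AdjoinRoot.mk P x)
  rw [← AdjoinRoot.map_eq_prod_X_sub_C_pow hP, aeval_map_algebraMap, aeval_precompEnd, ← hcard,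
    FiniteField.pow_card] at h
  exact h

end Reduction

/-! ### Orders, degrees and valuations of Carlitz values -/

section Carlitz

variable {F : Type*} [Field F] [Fintype F]

theorem carlitz_mul_apply (a b x : F[X]) :
    carlitz F (a * b) x = carlitz F a (carlitz F b x) := by
  rw [map_mul, Module.End.mul_apply]

theorem carlitz_X_apply (x : F[X]) : carlitz F X x = X * x + x ^ Fintype.card F := by
  rw [carlitz_X, carlitzT_apply]

theorem carlitz_C_apply (c : F) (x : F[X]) : carlitz F (C c) x = C c * x := by
  simp [carlitz, C_mul']

theorem carlitz_X_add_C_apply (c : F) (x : F[X]) :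
    carlitz F (X + C c) x = (X + C c) * x + x ^ Fintype.card F := by
  rw [map_add, LinearMap.add_apply, carlitz_X_apply, carlitz_C_apply]
  ring

/-- Only the linear term of `C_a` is not divisible by `x ^ q`. -/
theorem pow_card_dvd_carlitz_sub (a x : F[X]) :
    x ^ Fintype.card F ∣ carlitz F a x - a * x := by
  induction a using Polynomial.induction_on' with
  | add p r hp hr =>
    have : carlitz F (p + r) x - (p + r) * x =
        (carlitz F p x - p * x) + (carlitz F r x - r * x) := by
      rw [map_add, LinearMap.add_apply]; ring
    rw [this]
    exact dvd_add hp hr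
  | monomial n c =>
    induction n with
    | zero => simp [carlitz_C_apply]
    | succ n ih =>
      obtain ⟨y, hy⟩ := ih
      have hq : Fintype.card F ≠ 0 := Fintype.card_ne_zero
      have hx : x ∣ carlitz F (monomial n c) x := by
        rw [← sub_add_cancel (carlitz F (monomial n c) x) (monomial n c * x), hy]
        exact dvd_add ((dvd_pow_self x hq).mul_right y) (dvd_mul_left x _)
      have h : carlitz F (monomial (n + 1) c) x - monomial (n + 1) c * x =
          X * (carlitz F (monomial n c) x - monomial n c * x) +
            carlitz F (monomial n c) x ^ Fintype.card F := by
        rw [← X_mul_monomial, carlitz_mul_apply, carlitz_X_apply]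
        ring
      rw [h, hy]
      exact dvd_add ((dvd_mul_right _ y).mul_left X) (pow_dvd_pow_of_dvd hx _)

theorem dvd_carlitz (a x : F[X]) : x ∣ carlitz F a x := by
  rw [← sub_add_cancel (carlitz F a x) (a * x)]
  exact dvd_add ((dvd_pow_self x Fintype.card_ne_zero).trans (pow_card_dvd_carlitz_sub a x))
    (dvd_mul_left x a)

theorem dvd_carlitz_of_dvd {P x : F[X]} (h : P ∣ x) (a : F[X]) : P ∣ carlitz F a x :=
  h.trans (dvd_carlitz a x)

/-- The order of `u` in the Carlitz module structure on `A / P`. -/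
theorem exists_carlitz_order {P : F[X]} (hP : P.Monic) (hprime : Prime P) (u : F[X]) :
    ∃ m₀ : F[X], m₀.Monic ∧ m₀ ∣ P - 1 ∧ ∀ a, P ∣ carlitz F a u ↔ m₀ ∣ a := by
  let I : Ideal F[X] :=
    { carrier := {a | P ∣ carlitz F a u}
      add_mem' := fun {a b} ha hb ↦ by
        simp only [Set.mem_ofPred_eq, map_add, LinearMap.add_apply] at *
        exact dvd_add ha hb
      zero_mem' := by simp
      smul_mem' := fun c a ha ↦ by
        simp only [Set.mem_ofPred_eq, smul_eq_mul, carlitz_mul_apply] at *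
        exact dvd_carlitz_of_dvd ha c }
  have hI (a : F[X]) : P ∣ carlitz F a u ↔ Submodule.IsPrincipal.generator I ∣ a :=
    (Submodule.IsPrincipal.mem_iff_generator_dvd I (x := a))
  have hP1 : Submodule.IsPrincipal.generator I ∣ P - 1 := by
    rw [← hI, map_sub, LinearMap.sub_apply, map_one, Module.End.one_apply]
    exact dvd_carlitz_self_sub hP hprime.irreducible u
  set g := Submodule.IsPrincipal.generator I
  have hg : g ≠ 0 := by
    rintro h
    rw [h, zero_dvd_iff, sub_eq_zero] at hP1
    exact hprime.not_isUnit (hP1 ▸ isUnit_one)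
  have hu : IsUnit (C g.leadingCoeff⁻¹) :=
    isUnit_C.2 (inv_ne_zero (leadingCoeff_ne_zero.2 hg)).isUnit
  refine ⟨g * C g.leadingCoeff⁻¹, monic_mul_leadingCoeff_inv hg, ?_, fun a ↦ ?_⟩
  · exact (hu.mul_right_dvd).2 hP1
  · rw [hI, hu.mul_right_dvd]

theorem natDegree_carlitz (hq : 2 < Fintype.card F) {x : F[X]} (hx : 1 ≤ x.natDegree)
    {a : F[X]} (ha : a ≠ 0) :
    (carlitz F a x).natDegree = Fintype.card F ^ a.natDegree * x.natDegree := by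
  induction hn : a.natDegree generalizing a with
  | zero =>
    obtain ⟨c, rfl⟩ := natDegree_eq_zero.1 hn
    have hc : c ≠ 0 := by rintro rfl; simp at ha
    rw [carlitz_C_apply, natDegree_C_mul hc]
    simp
  | succ n ih =>
    have hb : a.divX.natDegree = n := by rw [natDegree_divX_eq_natDegree_tsub_one, hn]; simp
    have hb0 : a.divX ≠ 0 := by
      intro h
      rw [divX_eq_zero_iff] at h
      rw [h] at hn
      simp at hn
    have hy := ih hb0 hb
    set y := carlitz F a.divX x
    have hpos : 1 ≤ Fintype.card F ^ n := Nat.one_le_pow _ _ (by omega)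
    have hyx : x.natDegree ≤ y.natDegree := by rw [hy]; nlinarith
    have hy0 : y ≠ 0 := by rintro h; rw [h] at hyx; simp at hyx; omega
    have key : carlitz F a x = y ^ Fintype.card F + (X * y + C (a.coeff 0) * x) := by
      conv_lhs => rw [← divX_mul_X_add a, mul_comm]
      rw [map_add, LinearMap.add_apply, carlitz_mul_apply, carlitz_X_apply, carlitz_C_apply]
      ring
    have hlt : (X * y + C (a.coeff 0) * x).natDegree < (y ^ Fintype.card F).natDegree := by
      rw [natDegree_pow]
      refine (natDegree_add_le_of_degree_le (n := y.natDegree + 1) ?_ ?_).trans_lt ?_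
      · rw [natDegree_X_mul hy0]
      · exact (natDegree_C_mul_le _ _).trans (by omega)
      · nlinarith
    rw [key, natDegree_add_eq_left_of_natDegree_lt hlt, natDegree_pow, hy, pow_succ]
    ring

theorem carlitz_one_eq (a : F[X]) :
    carlitz F a 1 = carlitz F a.divX (X + C 1) + C (a.coeff 0) := by
  conv_lhs => rw [← divX_mul_X_add a]
  rw [map_add, LinearMap.add_apply, carlitz_mul_apply, carlitz_X_apply, carlitz_C_apply]
  simp

theorem natDegree_carlitz_one (hq : 2 < Fintype.card F) {a : F[X]} (ha : 1 ≤ a.natDegree) :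
    (carlitz F a 1).natDegree = Fintype.card F ^ (a.natDegree - 1) := by
  have hb : a.divX ≠ 0 := by
    intro h
    rw [divX_eq_zero_iff] at h
    rw [h] at ha
    simp at ha
  rw [carlitz_one_eq, natDegree_add_C, natDegree_carlitz hq (by rw [natDegree_X_add_C]) hb,
    natDegree_X_add_C, natDegree_divX_eq_natDegree_tsub_one, mul_one]

theorem carlitz_one_of_natDegree_eq_zero {a : F[X]} (ha : a.natDegree = 0) :
    carlitz F a 1 = a := by
  obtain ⟨c, rfl⟩ := natDegree_eq_zero.1 ha
  rw [carlitz_C_apply, mul_one]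

/-- For `q > 2` the Carlitz module has no torsion in `A`. -/
theorem carlitz_ne_zero (hq : 2 < Fintype.card F) {u a : F[X]} (hu : u.Monic) (ha : a ≠ 0) :
    carlitz F a u ≠ 0 := by
  rcases Nat.eq_zero_or_pos u.natDegree with h | h
  · rw [hu.natDegree_eq_zero.1 h]
    rcases Nat.eq_zero_or_pos a.natDegree with h' | h'
    · rwa [carlitz_one_of_natDegree_eq_zero h']
    · apply ne_zero_of_natDegree_gt (n := 0)
      rw [natDegree_carlitz_one hq h']
      exact Nat.pow_pos (by omega)
  · apply ne_zero_of_natDegree_gt (n := 0)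
    rw [natDegree_carlitz hq h ha]
    exact Nat.mul_pos (Nat.pow_pos (by omega)) h

/-- Lifting the exponent: once `P` divides `x`, applying `C_a` raises the valuation by that
of `a`. This is where `q > 2` enters, as the term `a * x` has to dominate `x ^ q`. -/
theorem multiplicity_carlitz (hq : 2 < Fintype.card F) {P x a : F[X]} (hP : Prime P)
    (hPx : P ∣ x) (hx : x ≠ 0) (ha : a ≠ 0) :
    multiplicity P (carlitz F a x) = multiplicity P a + multiplicity P x := by
  have hdegP : 1 ≤ P.natDegree := hP.irreducible.natDegree_pos
  have hdeg {y : F[X]} (hPy : P ∣ y) (hy : y ≠ 0) : 1 ≤ y.natDegree :=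
    hdegP.trans (natDegree_le_of_dvd hPy hy)
  have hne {y b : F[X]} (hPy : P ∣ y) (hy : y ≠ 0) (hb : b ≠ 0) : carlitz F b y ≠ 0 := by
    apply ne_zero_of_natDegree_gt (n := 0)
    rw [natDegree_carlitz hq (hdeg hPy hy) hb]
    exact Nat.mul_pos (Nat.pow_pos (by omega)) (hdeg hPy hy)
  have fin {y : F[X]} (hy : y ≠ 0) : FiniteMultiplicity P y := .of_prime_left hP hy
  have small {y b : F[X]} (hPy : P ∣ y) (hy : y ≠ 0) (hb : b ≠ 0) (hb1 : multiplicity P b ≤ 1) :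
      multiplicity P (carlitz F b y) = multiplicity P b + multiplicity P y := by
    have hby : b * y ≠ 0 := mul_ne_zero hb hy
    have hv : multiplicity P (b * y) = multiplicity P b + multiplicity P y :=
      multiplicity_mul hP (fin hby)
    have hv1 : 1 ≤ multiplicity P y := multiplicity_pos_of_dvd hPy
    have hbig : P ^ (multiplicity P (b * y) + 1) ∣ carlitz F b y - b * y := by
      refine (pow_dvd_pow P (n := multiplicity P y * Fintype.card F) ?_).trans ?_
      · nlinarith
      · rw [pow_mul]
        exact (pow_dvd_pow_of_dvd (pow_multiplicity_dvd P y) _).trans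
          (pow_card_dvd_carlitz_sub b y)
    rw [← hv]
    apply multiplicity_eq_of_dvd_of_not_dvd
    · exact (dvd_iff_dvd_of_dvd_sub ((pow_dvd_pow P (Nat.le_succ _)).trans hbig)).2
        (pow_multiplicity_dvd P _)
    · rw [dvd_iff_dvd_of_dvd_sub hbig]
      exact (fin hby).not_pow_dvd_of_multiplicity_lt (Nat.lt_succ_self _)
  obtain ⟨k, b, hPb, rfl⟩ := WfDvdMonoid.max_power_factor ha hP.irreducible
  have hb : b ≠ 0 := right_ne_zero_of_mul ha
  have hb0 : multiplicity P b = 0 := multiplicity_eq_zero.2 hPb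
  rw [multiplicity_mul hP (fin ha), multiplicity_pow_self_of_prime hP, hb0, add_zero]
  clear ha
  induction k with
  | zero => rw [pow_zero, one_mul, small hPx hx hb (by omega), hb0]
  | succ k ih =>
    have hk : P ^ k * b ≠ 0 := mul_ne_zero (pow_ne_zero _ hP.ne_zero) hb
    rw [pow_succ', mul_assoc, carlitz_mul_apply,
      small (dvd_carlitz_of_dvd hPx _) (hne hPx hx hk) hP.ne_zero (by rw [multiplicity_self]), ih,
      multiplicity_self]
    ring

end Carlitz

/-! ### The primitive part of a Carlitz value -/

section AltSum

variable {ι : Type*} [DecidableEq ι]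

/-- The alternating sum of `g` over the subsets of `s`, with `g s` counted positively. -/
def altSum (s : Finset ι) (g : Finset ι → ℤ) : ℤ :=
  ∑ S ∈ s.powerset, (-1) ^ (s \ S).card * g S

/-- Subsets with and without `i` are paired. -/
theorem altSum_eq_altSum_erase {s : Finset ι} {i : ι} (hi : i ∈ s) (g : Finset ι → ℤ) :
    altSum s g = altSum (s.erase i) fun S ↦ g (insert i S) - g S := by
  have hni : i ∉ s.erase i := Finset.notMem_erase i s
  unfold altSum
  conv_lhs => rw [← Finset.insert_erase hi]
  rw [Finset.sum_powerset_insert hni, ← Finset.sum_add_distrib]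
  refine Finset.sum_congr rfl fun S hS ↦ ?_
  have hiS : i ∉ S := fun h ↦ hni (Finset.mem_powerset.1 hS h)
  rw [Finset.insert_sdiff_of_notMem _ hiS, Finset.insert_sdiff_insert,
    Finset.card_insert_of_notMem (fun h ↦ hni (Finset.mem_sdiff.1 h).1),
    Finset.sdiff_insert_of_notMem hni]
  ring

theorem altSum_eq_zero {s : Finset ι} {g : Finset ι → ℤ} (h : ∀ S ⊆ s, g S = 0) :
    altSum s g = 0 :=
  Finset.sum_eq_zero fun S hS ↦ by rw [h S (Finset.mem_powerset.1 hS), mul_zero]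

theorem altSum_eq_apply {s : Finset ι} {g : Finset ι → ℤ} (h : ∀ S ⊂ s, g S = 0) :
    altSum s g = g s := by
  unfold altSum
  rw [Finset.sum_eq_single s]
  · simp
  · intro S hS hne
    rw [h S ((Finset.mem_powerset.1 hS).ssubset_of_ne hne), mul_zero]
  · simp

theorem altSum_eq_sum_sub_sum (s : Finset ι) (g : Finset ι → ℤ) :
    altSum s g = ∑ S ∈ s.powerset with Even (s \ S).card, g S -
      ∑ S ∈ s.powerset with ¬ Even (s \ S).card, g S := by
  unfold altSum
  rw [← Finset.sum_filter_add_sum_filter_not _ (fun S ↦ Even (s \ S).card), sub_eq_add_neg,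
    ← Finset.sum_neg_distrib]
  congr 1
  · refine Finset.sum_congr rfl fun S hS ↦ ?_
    rw [(Finset.mem_filter.1 hS).2.neg_one_pow, one_mul]
  · refine Finset.sum_congr rfl fun S hS ↦ ?_
    rw [(Nat.not_even_iff_odd.1 (Finset.mem_filter.1 hS).2).neg_one_pow, neg_one_mul]

theorem altSum_prod (s : Finset ι) (f : ι → ℤ) (c : ℤ) :
    altSum s (fun S ↦ c * ∏ i ∈ S, f i) = c * ∏ i ∈ s, (f i - 1) := by
  simp_rw [sub_eq_add_neg]
  rw [Finset.prod_add, Finset.mul_sum]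
  refine Finset.sum_congr rfl fun S _ ↦ ?_
  rw [Finset.prod_const]
  ring

end AltSum

section Primitive

variable {F : Type*} [Field F]

theorem exists_monic_associated {P : F[X]} (hP : P ≠ 0) : ∃ Q : F[X], Q.Monic ∧ Associated P Q := by
  have hu : IsUnit (C P.leadingCoeff⁻¹) :=
    isUnit_C.2 (inv_ne_zero (leadingCoeff_ne_zero.2 hP)).isUnit
  exact ⟨_, monic_mul_leadingCoeff_inv hP, (associated_mul_unit_left P _ hu).symm⟩

theorem exists_monic_prime_dvd {a : F[X]} (ha : a ≠ 0) (hu : ¬ IsUnit a) :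
    ∃ Q : F[X], Q.Monic ∧ Prime Q ∧ Q ∣ a := by
  obtain ⟨p, hp, hpa⟩ := WfDvdMonoid.exists_irreducible_factor hu ha
  obtain ⟨Q, hQ, hpQ⟩ := exists_monic_associated hp.ne_zero
  exact ⟨Q, hQ, hpQ.prime hp.prime, hpQ.dvd_iff_dvd_left.1 hpa⟩

theorem eq_of_monic_prime_dvd {P Q : F[X]} (hP : P.Monic) (hPp : Prime P) (hQ : Q.Monic)
    (hQp : Prime Q) (h : P ∣ Q) : P = Q :=
  eq_of_monic_of_associated hP hQ (hPp.associated_of_dvd hQp h)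

/-- `s` is the set of monic primes dividing `m = m' * ∏ p ∈ s, p`. Then the divisors `m / d` of `m`
with `d` squarefree are the `m' * ∏ p ∈ S, p` with `S ⊆ s`. -/
structure IsRadicalDecomposition (m m' : F[X]) (s : Finset F[X]) : Prop where
  monic : m'.Monic
  eq : m = m' * ∏ p ∈ s, p
  monic_of_mem : ∀ p ∈ s, p.Monic
  prime_of_mem : ∀ p ∈ s, Prime p
  mem_of_dvd : ∀ p : F[X], p.Monic → Prime p → p ∣ m → p ∈ s

theorem exists_isRadicalDecomposition {m : F[X]} (hm : m.Monic) :
    ∃ m' s, IsRadicalDecomposition m m' s := by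
  classical
  have hfin : {p : F[X] | p.Monic ∧ Prime p ∧ p ∣ m}.Finite := by
    have hf : Finite {g : F[X] // g.Monic ∧ g ∣ m} :=
      @Finite.of_fintype _ (fintypeSubtypeMonicDvd m hm.ne_zero)
    exact ((Set.finite_coe_iff (s := {g : F[X] | g.Monic ∧ g ∣ m})).1 hf).subset
      fun p hp ↦ ⟨hp.1, hp.2.2⟩
  have hmem (p : F[X]) : p ∈ hfin.toFinset ↔ p.Monic ∧ Prime p ∧ p ∣ m := by simp
  have hdvd : ∏ p ∈ hfin.toFinset, p ∣ m := by
    refine Finset.prod_dvd_of_coprime (fun p hp r hr hpr ↦ ?_) fun p hp ↦ ((hmem p).1 hp).2.2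
    have hp' := (hmem p).1 hp
    have hr' := (hmem r).1 hr
    refine (hp'.2.1.irreducible.coprime_iff_not_dvd).2 fun h ↦ hpr ?_
    exact eq_of_monic_prime_dvd hp'.1 hp'.2.1 hr'.1 hr'.2.1 h
  obtain ⟨m', hm'⟩ := hdvd
  refine ⟨m', hfin.toFinset, ?_, by rw [mul_comm]; exact hm', fun p hp ↦ ((hmem p).1 hp).1,
    fun p hp ↦ ((hmem p).1 hp).2.1, fun p h1 h2 h3 ↦ (hmem p).2 ⟨h1, h2, h3⟩⟩
  refine Monic.of_mul_monic_left (monic_prod_of_monic _ _ fun p hp ↦ ((hmem p).1 hp).1) ?_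
  rw [← hm']
  exact hm

namespace IsRadicalDecomposition

variable {m m' : F[X]} {s : Finset F[X]}

theorem ne_zero_of_subset (h : IsRadicalDecomposition m m' s) {S : Finset F[X]} (hS : S ⊆ s) :
    m' * ∏ p ∈ S, p ≠ 0 :=
  mul_ne_zero h.monic.ne_zero
    (Finset.prod_ne_zero_iff.2 fun p hp ↦ (h.monic_of_mem p (hS hp)).ne_zero)

theorem monic_self (h : IsRadicalDecomposition m m' s) : m.Monic :=
  h.eq ▸ h.monic.mul (monic_prod_of_monic _ _ h.monic_of_mem)

theorem mul_dvd_of_notMem (h : IsRadicalDecomposition m m' s) {S : Finset F[X]} (hS : S ⊆ s)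
    {Q : F[X]} (hQ : Q ∈ s) (hQS : Q ∉ S) : m' * (∏ p ∈ S, p) * Q ∣ m := by
  classical
  rw [h.eq, mul_assoc, mul_comm (∏ p ∈ S, p), ← Finset.prod_insert (f := fun p ↦ p) hQS]
  exact mul_dvd_mul_left _ (Finset.prod_dvd_prod_of_subset _ _ _ (Finset.insert_subset hQ hS))

end IsRadicalDecomposition

variable [Fintype F]

/-- The primes `P` dividing the primitive part of `C_m(u)` although `u` has order less than `m`
modulo `P`: the order of `u` modulo `P` is `m` up to a power of `P`. -/
def IsIntrinsicPrime (u m P : F[X]) : Prop :=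
  ∃ (m₀ : F[X]) (k : ℕ), m₀.Monic ∧ k ≠ 0 ∧ m = m₀ * P ^ k ∧ m₀ ∣ P - 1 ∧ P ∣ carlitz F m₀ u

theorem multiplicity_carlitz_mul (hq : 2 < Fintype.card F) {u P a b : F[X]} (hu : u.Monic)
    (hP : Prime P) (ha : P ∣ carlitz F a u) (ha0 : a ≠ 0) (hb : b ≠ 0) :
    multiplicity P (carlitz F (a * b) u) = multiplicity P b + multiplicity P (carlitz F a u) := by
  rw [mul_comm, carlitz_mul_apply, multiplicity_carlitz hq hP ha (carlitz_ne_zero hq hu ha0) hb]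

open Classical in
/-- The valuation at `P` of the primitive part `∏ C_{m / d}(u) ^ μ(d)` of `C_m(u)`, where `d` runs
over the squarefree divisors of `m`. It is that of `C_m(u)` at Zsigmondy primes, `1` at intrinsic
primes and `0` elsewhere. -/
theorem altSum_multiplicity (hq : 2 < Fintype.card F) {u m m' P : F[X]} {s : Finset F[X]}
    (hu : u.Monic) (h : IsRadicalDecomposition m m' s) (hP : P.Monic) (hPp : Prime P) :
    altSum s (fun S ↦ multiplicity P (carlitz F (m' * ∏ p ∈ S, p) u)) = 0 ∨
    (IsZsigmondyPrime u m P ∧ m ∣ P - 1 ∧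
      altSum s (fun S ↦ multiplicity P (carlitz F (m' * ∏ p ∈ S, p) u)) =
        multiplicity P (carlitz F m u)) ∨
    (IsIntrinsicPrime u m P ∧
      altSum s (fun S ↦ multiplicity P (carlitz F (m' * ∏ p ∈ S, p) u)) = 1) := by
  obtain ⟨m₀, hm₀, hm₀P, hord⟩ := exists_carlitz_order hP hPp u
  have hm0 : m ≠ 0 := h.monic_self.ne_zero
  have hzero {a : F[X]} (ha : ¬ m₀ ∣ a) : multiplicity P (carlitz F a u) = 0 :=
    multiplicity_eq_zero.2 fun h' ↦ ha ((hord a).1 h')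
  have hPm₀ : P ∣ carlitz F m₀ u := (hord m₀).2 dvd_rfl
  by_cases hdvd : m₀ ∣ m
  swap
  · left
    refine altSum_eq_zero fun S hS ↦ ?_
    rw [hzero fun h' ↦ hdvd (h'.trans ?_), Nat.cast_zero]
    rw [h.eq]
    exact mul_dvd_mul_left _ (Finset.prod_dvd_prod_of_subset _ _ _ hS)
  obtain ⟨t, ht⟩ := hdvd
  have htm : t.Monic := hm₀.of_mul_monic_left (ht ▸ h.monic_self)
  by_cases hQ : ∃ Q ∈ s, Q ≠ P ∧ Q ∣ t
  · obtain ⟨Q, hQs, hQP, r, hr⟩ := hQ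
    left
    rw [altSum_eq_altSum_erase hQs]
    refine altSum_eq_zero fun S hS ↦ ?_
    have hSs : S ⊆ s := hS.trans (Finset.erase_subset _ _)
    have hQS : Q ∉ S := fun h' ↦ Finset.notMem_erase Q s (hS h')
    have hQp := h.prime_of_mem Q hQs
    have hPQ : ¬ P ∣ Q := fun h' ↦
      hQP (eq_of_monic_prime_dvd hP hPp (h.monic_of_mem Q hQs) hQp h').symm
    have ha : m' * ∏ p ∈ S, p ≠ 0 := h.ne_zero_of_subset hSs
    have hins : m' * ∏ p ∈ insert Q S, p = (m' * ∏ p ∈ S, p) * Q := by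
      rw [Finset.prod_insert hQS]; ring
    rw [hins, sub_eq_zero, Nat.cast_inj]
    by_cases hmS : m₀ ∣ m' * ∏ p ∈ S, p
    · rw [multiplicity_carlitz_mul hq hu hPp ((hord _).2 hmS) ha hQp.ne_zero,
        multiplicity_eq_zero.2 hPQ, zero_add]
    · -- `m₀` divides `m / Q`, so dividing `m' * ∏ S` is not affected by the factor `Q`
      rw [hzero hmS, hzero]
      intro hmQ
      apply hmS
      have hcop : IsCoprime Q (∏ p ∈ s.erase Q \ S, p) := by
        refine IsCoprime.prod_right fun p hp ↦ ?_
        have hp' := Finset.mem_erase.1 (Finset.mem_sdiff.1 hp).1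
        refine hQp.irreducible.coprime_iff_not_dvd.2 fun h' ↦ hp'.1 ?_
        exact (eq_of_monic_prime_dvd (h.monic_of_mem Q hQs) hQp (h.monic_of_mem p hp'.2)
          (h.prime_of_mem p hp'.2) h').symm
      have hmR : m₀ ∣ (m' * ∏ p ∈ S, p) * ∏ p ∈ s.erase Q \ S, p := by
        refine ⟨r, mul_right_cancel₀ hQp.ne_zero ?_⟩
        have h1 : (∏ p ∈ S, p) * ∏ p ∈ s.erase Q \ S, p = ∏ p ∈ s.erase Q, p := by
          rw [mul_comm, Finset.prod_sdiff hS]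
        calc _ = m' * (((∏ p ∈ S, p) * ∏ p ∈ s.erase Q \ S, p) * Q) := by ring
          _ = m := by rw [h1, Finset.prod_erase_mul _ _ hQs, h.eq]
          _ = m₀ * r * Q := by rw [ht, hr]; ring
      obtain ⟨x, y, hxy⟩ := hcop
      have := dvd_add (hmQ.mul_left x) (hmR.mul_left y)
      convert this using 1
      linear_combination (-(m' * ∏ p ∈ S, p)) * hxy
  push Not at hQ
  -- now `m / m₀` is a power of `P`
  obtain ⟨k, hk⟩ : ∃ k : ℕ, t = P ^ k := by
    obtain ⟨k, b, hPb, hb⟩ := WfDvdMonoid.max_power_factor htm.ne_zero hPp.irreducible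
    have hbm : b.Monic := (hP.pow k).of_mul_monic_left (hb ▸ htm)
    refine ⟨k, ?_⟩
    by_cases hbu : IsUnit b
    · rw [hb, hbm.eq_one_of_isUnit hbu, mul_one]
    · obtain ⟨Q, hQm, hQp, hQb⟩ := exists_monic_prime_dvd hbm.ne_zero hbu
      have hQt : Q ∣ t := hb ▸ hQb.mul_left _
      have hQs := h.mem_of_dvd Q hQm hQp (ht ▸ hQt.mul_left _)
      exact absurd hQt (hQ Q hQs fun h' ↦ hPb (h' ▸ hQb))
  subst hk
  have key {S : Finset F[X]} (hS : S ⊆ s) {Q : F[X]} (hQs : Q ∈ s) (hQS : Q ∉ S)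
      (hQt : ¬ Q ∣ P ^ k) : ¬ m₀ ∣ m' * ∏ p ∈ S, p := by
    rintro ⟨b, hb⟩
    have h1 := h.mul_dvd_of_notMem hS hQs hQS
    rw [hb, ht, mul_assoc, mul_dvd_mul_iff_left hm₀.ne_zero] at h1
    exact hQt ((dvd_mul_left Q b).trans h1)
  right
  rcases Nat.eq_zero_or_pos k with rfl | hk
  · left
    rw [pow_zero, mul_one] at ht
    subst ht
    refine ⟨⟨hP, hPp, hPm₀, fun n hn hdeg hPn ↦ ?_⟩, hm₀P, ?_⟩
    · exact absurd (degree_le_of_dvd ((hord n).1 hPn) hn) (not_le.2 hdeg)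
    · rw [altSum_eq_apply, ← h.eq]
      intro S hS
      obtain ⟨Q, hQs, hQS⟩ := Finset.exists_of_ssubset hS
      rw [hzero (key hS.1 hQs hQS fun h' ↦ ?_), Nat.cast_zero]
      rw [pow_zero] at h'
      exact (h.prime_of_mem Q hQs).not_isUnit (isUnit_of_dvd_one h')
  · right
    refine ⟨⟨m₀, k, hm₀, by omega, ht, hm₀P, hPm₀⟩, ?_⟩
    have hPs : P ∈ s := h.mem_of_dvd P hP hPp (ht ▸ (dvd_pow_self P (by omega)).mul_left _)
    rw [altSum_eq_altSum_erase hPs, altSum_eq_apply]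
    · obtain ⟨j, rfl⟩ : ∃ j, k = j + 1 := ⟨k - 1, by omega⟩
      have h1 : m' * ∏ p ∈ s.erase P, p = m₀ * P ^ j := by
        apply mul_right_cancel₀ hPp.ne_zero
        rw [mul_assoc, Finset.prod_erase_mul _ _ hPs, ← h.eq, ht]
        ring
      rw [Finset.insert_erase hPs, ← h.eq, h1, ht,
        multiplicity_carlitz_mul hq hu hPp hPm₀ hm₀.ne_zero (pow_ne_zero _ hPp.ne_zero),
        multiplicity_carlitz_mul hq hu hPp hPm₀ hm₀.ne_zero (pow_ne_zero _ hPp.ne_zero),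
        multiplicity_pow_self_of_prime hPp, multiplicity_pow_self_of_prime hPp]
      push_cast
      ring
    · intro S hS
      obtain ⟨Q, hQs, hQS⟩ := Finset.exists_of_ssubset hS
      rw [Finset.mem_erase] at hQs
      have hSs : S ⊆ s := hS.1.trans (Finset.erase_subset _ _)
      have hQt : ¬ Q ∣ P ^ k := fun h' ↦ hQs.1 <|
        eq_of_monic_prime_dvd (h.monic_of_mem Q hQs.2) (h.prime_of_mem Q hQs.2) hP hPp
          ((h.prime_of_mem Q hQs.2).dvd_of_dvd_pow h')
      rw [hzero (key hSs hQs.2 hQS hQt), hzero (key (Finset.insert_subset hPs hSs) hQs.2 ?_ hQt),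
        sub_self]
      rw [Finset.mem_insert, not_or]
      exact ⟨hQs.1, hQS⟩

end Primitive

/-! ### The totient bound -/

section Bound

variable {F : Type*} [Field F]

theorem multiplicity_prod {ι : Type*} {P : F[X]} (hP : Prime P) (s : Finset ι) (f : ι → F[X])
    (hf : ∀ i ∈ s, f i ≠ 0) :
    multiplicity P (∏ i ∈ s, f i) = ∑ i ∈ s, multiplicity P (f i) := by
  classical
  induction s using Finset.induction with
  | empty => simpa using multiplicity_of_one_right hP.not_isUnit
  | insert a s has ih =>
    rw [Finset.prod_insert has, Finset.sum_insert has, multiplicity_mul hP,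
      ih fun i hi ↦ hf i (Finset.mem_insert_of_mem hi)]
    exact .of_prime_left hP (mul_ne_zero (hf a (Finset.mem_insert_self a s))
      (Finset.prod_ne_zero_iff.2 fun i hi ↦ hf i (Finset.mem_insert_of_mem hi)))

theorem dvd_of_multiplicity_le {a b : F[X]} (ha : a ≠ 0) (hb : b ≠ 0)
    (h : ∀ P : F[X], P.Monic → Prime P → multiplicity P a ≤ multiplicity P b) : a ∣ b := by
  rw [UniqueFactorizationMonoid.dvd_iff_emultiplicity_le ha]
  intro p hp
  obtain ⟨Q, hQ, hpQ⟩ := exists_monic_associated hp.ne_zero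
  have hQp := hpQ.prime hp
  rw [← emultiplicity_eq_of_associated_left hpQ, ← emultiplicity_eq_of_associated_left hpQ,
    (FiniteMultiplicity.of_prime_left hQp ha).emultiplicity_eq_multiplicity,
    (FiniteMultiplicity.of_prime_left hQp hb).emultiplicity_eq_multiplicity]
  exact_mod_cast h Q hQ hQp

variable [Fintype F]

/-- The number `φ(m)` of units of `A / m`, in terms of `m = m' * ∏ p ∈ s, p`. -/
def polyTotient (m' : F[X]) (s : Finset F[X]) : ℕ :=
  Fintype.card F ^ m'.natDegree * ∏ p ∈ s, (Fintype.card F ^ p.natDegree - 1)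

theorem pow_sub_one_le {q : ℕ} (hq : 2 < q) {d : ℕ} (hd : 1 ≤ d) : (q - 1) ^ d ≤ q ^ d - 1 := by
  have : (q - 1) ^ d < q ^ d := Nat.pow_lt_pow_left (by omega) (by omega)
  omega

namespace IsRadicalDecomposition

variable {m m' : F[X]} {s : Finset F[X]}

omit [Fintype F] in
theorem natDegree_eq (h : IsRadicalDecomposition m m' s) {S : Finset F[X]} (hS : S ⊆ s) :
    (m' * ∏ p ∈ S, p).natDegree = m'.natDegree + ∑ p ∈ S, p.natDegree := by
  have hm : ∀ p ∈ S, p.Monic := fun p hp ↦ h.monic_of_mem p (hS hp)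
  rw [h.monic.natDegree_mul (monic_prod_of_monic _ _ hm), natDegree_prod_of_monic _ _ hm]

omit [Fintype F] in
theorem one_le_natDegree (h : IsRadicalDecomposition m m' s) {p : F[X]} (hp : p ∈ s) :
    1 ≤ p.natDegree :=
  (h.prime_of_mem p hp).irreducible.natDegree_pos

theorem pow_le_prod (hq : 2 < Fintype.card F) (h : IsRadicalDecomposition m m' s)
    {S : Finset F[X]} (hS : S ⊆ s) :
    (Fintype.card F - 1) ^ ∑ p ∈ S, p.natDegree ≤
      ∏ p ∈ S, (Fintype.card F ^ p.natDegree - 1) := by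
  rw [← Finset.prod_pow_eq_pow_sum]
  exact Finset.prod_le_prod' fun p hp ↦ pow_sub_one_le hq (h.one_le_natDegree (hS hp))

theorem pow_natDegree_le_totient (hq : 2 < Fintype.card F) (h : IsRadicalDecomposition m m' s) :
    (Fintype.card F - 1) ^ m.natDegree ≤ polyTotient m' s := by
  rw [h.eq, h.natDegree_eq subset_rfl, pow_add]
  exact Nat.mul_le_mul (Nat.pow_le_pow_left (Nat.sub_le _ _) _) (h.pow_le_prod hq subset_rfl)

theorem mul_pow_le_totient (hq : 2 < Fintype.card F) (h : IsRadicalDecomposition m m' s)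
    {m₀ P : F[X]} {k : ℕ} (hm₀ : m₀.Monic) (hP : P.Monic) (hPp : Prime P)
    (hm : m = m₀ * P ^ (k + 1)) :
    (Fintype.card F ^ P.natDegree - 1) * Fintype.card F ^ (P.natDegree * k) *
      (Fintype.card F - 1) ^ m₀.natDegree ≤ polyTotient m' s := by
  classical
  set q := Fintype.card F
  have hPs : P ∈ s := h.mem_of_dvd P hP hPp (hm ▸ (dvd_pow_self P (by omega)).mul_left _)
  have hprod : ∏ p ∈ s, p ∣ P * m₀ := by
    refine Finset.prod_dvd_of_coprime (fun p hp r hr hpr ↦ ?_) fun p hp ↦ ?_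
    · refine (h.prime_of_mem p hp).irreducible.coprime_iff_not_dvd.2 fun h' ↦ hpr ?_
      exact eq_of_monic_prime_dvd (h.monic_of_mem p hp) (h.prime_of_mem p hp)
        (h.monic_of_mem r hr) (h.prime_of_mem r hr) h'
    · have hpm : p ∣ m := h.eq ▸ (Finset.dvd_prod_of_mem (fun p ↦ p) hp).mul_left m'
      rw [hm] at hpm
      rcases (h.prime_of_mem p hp).dvd_or_dvd hpm with h' | h'
      · exact h'.mul_left P
      · exact ((h.prime_of_mem p hp).dvd_of_dvd_pow h').mul_right m₀
  have hmon := monic_prod_of_monic s (fun p ↦ p) h.monic_of_mem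
  have hle : ∑ p ∈ s, p.natDegree ≤ P.natDegree + m₀.natDegree := by
    rw [← natDegree_prod_of_monic _ _ h.monic_of_mem, ← hP.natDegree_mul hm₀]
    exact natDegree_le_of_dvd hprod (hP.mul hm₀).ne_zero
  have hdeg : m'.natDegree + ∑ p ∈ s, p.natDegree = m₀.natDegree + (k + 1) * P.natDegree := by
    rw [← h.natDegree_eq subset_rfl, ← h.eq, hm, hm₀.natDegree_mul (hP.pow _), hP.natDegree_pow]
  have hsum : ∑ p ∈ s, p.natDegree = P.natDegree + ∑ p ∈ s.erase P, p.natDegree :=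
    (Finset.add_sum_erase s _ hPs).symm
  obtain ⟨e, he⟩ : ∃ e, m'.natDegree = P.natDegree * k + e :=
    Nat.exists_eq_add_of_le (by rw [add_mul, mul_comm k] at hdeg; omega)
  have hm₀e : m₀.natDegree = e + ∑ p ∈ s.erase P, p.natDegree := by
    rw [add_mul, mul_comm k] at hdeg; omega
  unfold polyTotient
  rw [he, pow_add, hm₀e, pow_add, ← Finset.mul_prod_erase s _ hPs]
  have h1 : (q - 1) ^ e ≤ q ^ e := Nat.pow_le_pow_left (Nat.sub_le _ _) _
  have h2 := h.pow_le_prod hq (Finset.erase_subset P s)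
  calc _ ≤ (q ^ P.natDegree - 1) * q ^ (P.natDegree * k) *
        (q ^ e * ∏ p ∈ s.erase P, (q ^ p.natDegree - 1)) :=
        Nat.mul_le_mul_left _ (Nat.mul_le_mul h1 h2)
    _ = _ := by ring

end IsRadicalDecomposition

open Classical in
/-- The expansion `φ(m) = ∑ μ(d) |m / d|`. -/
theorem altSum_pow_natDegree (hq : 2 < Fintype.card F) (m' : F[X])
    (s : Finset F[X]) :
    altSum s (fun S ↦ (Fintype.card F : ℤ) ^ (m'.natDegree + ∑ p ∈ S, p.natDegree)) =
      polyTotient m' s := by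
  simp_rw [pow_add, ← Finset.prod_pow_eq_pow_sum]
  rw [altSum_prod, polyTotient, Nat.cast_mul, Nat.cast_prod, Nat.cast_pow]
  congr 1
  refine Finset.prod_congr rfl fun p _ ↦ ?_
  rw [Nat.cast_sub (Nat.one_le_pow _ _ (by omega))]
  simp

/-- If there is no large Zsigmondy prime, then the primitive part of `C_m(u)` divides `B`, or
`(m + 1) * B` if `m + 1` is a prime, where `B` is a product of intrinsic primes. As the degree of
the primitive part is given by `φ(m)`, this bounds `φ(m)`. -/
theorem totient_bound (hq : 2 < Fintype.card F) {u m m' : F[X]} {s : Finset F[X]}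
    (hu : u.Monic)
    (h : IsRadicalDecomposition m m' s) (hno : ¬ ∃ P : F[X], IsLargeZsigmondyPrime u m P) :
    ∃ B : F[X], B.Monic ∧ B ∣ m ∧
      (∀ P : F[X], P.Monic → Prime P → P ∣ B → IsIntrinsicPrime u m P) ∧
      ∃ e ≤ m.natDegree, (¬ Prime (m + 1) → e = 0) ∧
        (1 ≤ u.natDegree → polyTotient m' s * u.natDegree ≤ e + B.natDegree) ∧
        (u = 1 → polyTotient m' s ≤ Fintype.card F * (e + B.natDegree) + 1) := by
  classical
  have hm := h.monic_self
  set s₀ := s.filter fun P ↦ IsIntrinsicPrime u m P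
  have hs₀ : s₀ ⊆ s := Finset.filter_subset _ _
  set B : F[X] := ∏ p ∈ s₀, p
  have hB : B.Monic := monic_prod_of_monic _ _ fun p hp ↦ h.monic_of_mem p (hs₀ hp)
  set Z : F[X] := if Prime (m + 1) then m + 1 else 1
  have hZ : Z ≠ 0 := by
    by_cases hp : Prime (m + 1)
    · simpa [Z, hp] using hp.ne_zero
    · simp [Z, hp]
  set E : Finset F[X] → F[X] := fun S ↦ carlitz F (m' * ∏ p ∈ S, p) u
  have hE {S : Finset F[X]} (hS : S ∈ s.powerset) : E S ≠ 0 :=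
    carlitz_ne_zero hq hu (h.ne_zero_of_subset (Finset.mem_powerset.1 hS))
  -- the primitive part of `C_m(u)` is `N / D`
  set N : F[X] := ∏ S ∈ s.powerset with Even (s \ S).card, E S
  set D : F[X] := ∏ S ∈ s.powerset with ¬ Even (s \ S).card, E S
  have hN' : ∀ S ∈ s.powerset.filter fun S ↦ Even (s \ S).card, E S ≠ 0 :=
    fun S hS ↦ hE (Finset.mem_filter.1 hS).1
  have hD' : ∀ S ∈ s.powerset.filter fun S ↦ ¬ Even (s \ S).card, E S ≠ 0 :=
    fun S hS ↦ hE (Finset.mem_filter.1 hS).1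
  have hN : N ≠ 0 := Finset.prod_ne_zero_iff.2 hN'
  have hD : D ≠ 0 := Finset.prod_ne_zero_iff.2 hD'
  have hR : Z * B ≠ 0 := mul_ne_zero hZ hB.ne_zero
  have hdvd : N ∣ D * (Z * B) := by
    refine dvd_of_multiplicity_le hN (mul_ne_zero hD hR) fun P hP hPp ↦ ?_
    have hfin {a : F[X]} (ha : a ≠ 0) : FiniteMultiplicity P a := .of_prime_left hPp ha
    have hsum := altSum_eq_sum_sub_sum s (fun S ↦ multiplicity P (E S))
    rw [multiplicity_mul hPp (hfin (mul_ne_zero hD hR)), multiplicity_prod hPp _ _ hN',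
      multiplicity_prod hPp _ _ hD']
    zify
    suffices hle : altSum s (fun S ↦ multiplicity P (E S)) ≤ multiplicity P (Z * B) by linarith
    rcases altSum_multiplicity hq hu h hP hPp with h0 | ⟨hZs, hmP, h1⟩ | ⟨hI, h1⟩
    · rw [h0]; positivity
    · rw [h1, Nat.cast_le]
      have hnl : ¬ (m.degree < P.degree ∨ P ^ 2 ∣ carlitz F m u) := fun h' ↦ hno ⟨P, hZs, h'⟩
      rw [not_or, not_lt] at hnl
      -- `m ∣ P - 1` and `deg P ≤ deg m` leave only `P = m + 1`
      have hPm : P = m + 1 := by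
        have hlt : (P - 1).natDegree ≤ m.natDegree := by
          have := natDegree_le_natDegree hnl.1
          exact (natDegree_sub_le _ _).trans (by simpa using this)
        have hdP : P.degree ≠ 0 := (degree_pos_of_irreducible hPp.irreducible).ne'
        have hPm' : (P - 1).Monic := hP.sub_of_left (by
          rw [degree_one]; exact degree_pos_of_irreducible hPp.irreducible)
        rw [← eq_of_monic_of_dvd_of_natDegree_le hm hPm' hmP hlt, sub_add_cancel]
      have hZm : Z = P := by simp only [Z, ← hPm, if_pos hPp]
      have hlt : multiplicity P (carlitz F m u) < 2 :=
        ((hfin (carlitz_ne_zero hq hu hm.ne_zero)).multiplicity_lt_iff_not_dvd).2 hnl.2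
      have hge : 1 ≤ multiplicity P (Z * B) :=
        multiplicity_pos_of_dvd (hZm ▸ dvd_mul_right _ _)
      omega
    · rw [h1]
      have hPs : P ∈ s₀ := by
        refine Finset.mem_filter.2 ⟨h.mem_of_dvd P hP hPp ?_, hI⟩
        obtain ⟨m₀, k, -, hk, hmk, -⟩ := hI
        exact hmk ▸ (dvd_pow_self P hk).mul_left _
      have hge : 1 ≤ multiplicity P (Z * B) :=
        multiplicity_pos_of_dvd ((Finset.dvd_prod_of_mem (fun p ↦ p) hPs).mul_left _)
      exact_mod_cast hge
  have hdeg := natDegree_le_of_dvd hdvd (mul_ne_zero hD hR)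
  rw [natDegree_mul hD hR, natDegree_mul hZ hB.ne_zero, natDegree_prod _ _ hN',
    natDegree_prod _ _ hD'] at hdeg
  have hsum := altSum_eq_sum_sub_sum s (fun S ↦ ((E S).natDegree : ℤ))
  have halt : altSum s (fun S ↦ ((E S).natDegree : ℤ)) ≤ Z.natDegree + B.natDegree := by
    zify at hdeg
    linarith
  refine ⟨B, hB, ?_, ?_, Z.natDegree, ?_, ?_, ?_, ?_⟩
  · rw [h.eq]
    exact (Finset.prod_dvd_prod_of_subset _ _ _ hs₀).mul_left _
  · intro P hP hPp hPB
    obtain ⟨p, hp, hPp'⟩ := (hPp.dvd_finsetProd_iff _).1 hPB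
    rw [eq_of_monic_prime_dvd hP hPp (h.monic_of_mem p (hs₀ hp)) (h.prime_of_mem p (hs₀ hp)) hPp']
    exact (Finset.mem_filter.1 hp).2
  · by_cases hp : Prime (m + 1)
    · simp only [Z, hp, if_true]
      exact (natDegree_add_le _ _).trans (by simp)
    · simp [Z, hp]
  · intro hp
    simp [Z, hp]
  · intro hu1
    have h1 : altSum s (fun S ↦ ((E S).natDegree : ℤ)) = polyTotient m' s * u.natDegree := by
      rw [← altSum_pow_natDegree hq m' s]
      rw [altSum, altSum, Finset.sum_mul]
      refine Finset.sum_congr rfl fun S hS ↦ ?_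
      have hS' := Finset.mem_powerset.1 hS
      rw [natDegree_carlitz hq hu1 (h.ne_zero_of_subset hS'), h.natDegree_eq hS']
      push_cast
      ring
    rw [h1] at halt
    exact_mod_cast halt
  · rintro rfl
    -- `q * deg C_a(1)` is `|a|`, except for constant `a`, which occurs at most once in the sum
    set δ : Finset F[X] → ℤ := fun S ↦ if m'.natDegree + ∑ p ∈ S, p.natDegree = 0 then 1 else 0
    have h1 : (Fintype.card F : ℤ) * altSum s (fun S ↦ ((E S).natDegree : ℤ)) =
        polyTotient m' s - altSum s δ := by
      rw [← altSum_pow_natDegree hq m' s]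
      unfold altSum
      rw [Finset.mul_sum, ← Finset.sum_sub_distrib]
      refine Finset.sum_congr rfl fun S hS ↦ ?_
      have hS' := Finset.mem_powerset.1 hS
      have hd := h.natDegree_eq hS'
      rcases Nat.eq_zero_or_pos (m'.natDegree + ∑ p ∈ S, p.natDegree) with h0 | h0
      · simp only [δ, h0, if_true, E]
        rw [carlitz_one_of_natDegree_eq_zero (hd.trans h0), hd, h0]
        simp
      · simp only [δ, h0.ne', if_false, E]
        rw [natDegree_carlitz_one hq (by omega), hd]
        obtain ⟨j, hj⟩ : ∃ j, m'.natDegree + ∑ p ∈ S, p.natDegree = j + 1 :=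
          ⟨_, (Nat.succ_pred_eq_of_pos h0).symm⟩
        rw [hj]
        push_cast
        simp only [pow_succ]
        ring
    have h2 : altSum s δ ≤ 1 := by
      unfold altSum
      rw [Finset.sum_eq_single ∅]
      · have hδ : δ ∅ = 0 ∨ δ ∅ = 1 := by
          simp only [δ]
          split_ifs <;> simp
        rcases neg_one_pow_eq_or ℤ (s \ ∅).card with h' | h' <;> rcases hδ with h'' | h'' <;>
          rw [h', h''] <;> norm_num
      · intro S hS hne
        obtain ⟨p, hp⟩ := Finset.nonempty_iff_ne_empty.2 hne
        have hp1 := h.one_le_natDegree (Finset.mem_powerset.1 hS hp)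
        have hp2 := Finset.single_le_sum (f := fun p : F[X] ↦ p.natDegree)
          (fun _ _ ↦ Nat.zero_le _) hp
        have : m'.natDegree + ∑ p ∈ S, p.natDegree ≠ 0 := by
          omega
        simp only [δ, if_neg this, mul_zero]
      · simp
    have h3 := mul_le_mul_of_nonneg_left halt (Nat.cast_nonneg (α := ℤ) (Fintype.card F))
    zify
    linarith

end Bound

/-! ### The exceptional pairs -/

section Exceptions

variable {F : Type*} [Field F]

theorem degree_X_add_C_mul (a b : F) : ((X + C a) * (X + C b)).degree = 2 := by
  rw [degree_mul, degree_X_add_C, degree_X_add_C]; rfl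

theorem Polynomial.Monic.exists_eq_X_add_C {P : F[X]} (hP : P.Monic) (h : P.natDegree = 1) :
    ∃ a, P = X + C a :=
  ⟨_, hP.eq_X_add_C h⟩

theorem X_add_C_sub_one (a : F) : (X + C a - 1 : F[X]) = X + C (a - 1) := by
  rw [C_sub, C_1]; ring

theorem X_add_C_degree_cond {m : F[X]} (h : 1 < m.degree) (a : F) :
    (X + C a : F[X]) ≠ 0 ∧ (X + C a : F[X]).degree < m.degree :=
  ⟨X_add_C_ne_zero a, by rwa [degree_X_add_C]⟩

variable [Fintype F]

theorem IsZsigmondyPrime.dvd_sub_one {u m P : F[X]} (hm : m.Monic) (h : IsZsigmondyPrime u m P) :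
    m ∣ P - 1 := by
  obtain ⟨hP, hPp, hPm, hmin⟩ := h
  obtain ⟨m₀, hm₀, hm₀P, hord⟩ := exists_carlitz_order hP hPp u
  have hle : ¬ m₀.degree < m.degree := fun hlt ↦ hmin m₀ hm₀.ne_zero hlt ((hord m₀).2 dvd_rfl)
  rwa [eq_of_monic_of_dvd_of_natDegree_le hm₀ hm ((hord m).1 hPm)
    (natDegree_le_natDegree (not_lt.1 hle))]

/-- If `C_m(u)` is, up to one factor `m + 1`, composed of values `C_n(u)` with `n` of smaller degree
than `m`, then only a divisor of `m + 1` can be a Zsigmondy prime, and it is not large, being `1`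
modulo `m`. -/
theorem not_exists_isLargeZsigmondyPrime {u m : F[X]} (hm : m.Monic) (hdeg : 0 < m.degree)
    (l : List F[X]) (hl : ∀ n ∈ l, n ≠ 0 ∧ n.degree < m.degree)
    (h : carlitz F m u ∣ (m + 1) * (l.map fun n ↦ carlitz F n u).prod) :
    ¬ ∃ P : F[X], IsLargeZsigmondyPrime u m P := by
  rintro ⟨P, hZ, hlarge⟩
  obtain ⟨hP, hPp, hPm, hmin⟩ := id hZ
  have hPl : ¬ P ∣ (l.map fun n ↦ carlitz F n u).prod := by
    rw [hPp.dvd_prod_iff]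
    rintro ⟨a, ha, hPa⟩
    obtain ⟨n, hn, rfl⟩ := List.mem_map.1 ha
    exact hmin n (hl n hn).1 (hl n hn).2 hPa
  have hcop : IsCoprime P (l.map fun n ↦ carlitz F n u).prod :=
    hPp.irreducible.coprime_iff_not_dvd.2 hPl
  have hm1 : (m + 1).natDegree = m.natDegree := by
    simpa using natDegree_add_C (p := m) (a := 1)
  have hmpos : 0 < m.natDegree := natDegree_pos_iff_degree_pos.2 hdeg
  have hm0 : m + 1 ≠ 0 := ne_zero_of_natDegree_gt (n := 0) (by omega)
  rcases hlarge with hlt | hsq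
  · have h1 := natDegree_le_of_dvd (hcop.dvd_of_dvd_mul_right (hPm.trans h)) hm0
    have h2 := natDegree_lt_natDegree hm.ne_zero hlt
    omega
  · have h1 := natDegree_le_of_dvd ((hcop.pow_left (m := 2)).dvd_of_dvd_mul_right (hsq.trans h)) hm0
    have hP1 : P - 1 ≠ 0 := sub_ne_zero.2 fun h' ↦ hPp.not_isUnit (h' ▸ isUnit_one)
    have h2 := natDegree_le_of_dvd (hZ.dvd_sub_one hm) hP1
    have h3 : (P - 1).natDegree ≤ P.natDegree := (natDegree_sub_le _ _).trans (by simp)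
    rw [natDegree_pow] at h1
    omega

theorem card_cast_eq_zero (F : Type*) [Field F] [Fintype F] {n : ℕ} (h : Fintype.card F = n) :
    (n : F[X]) = 0 := by
  have := FiniteField.cast_card_eq_zero F
  rw [← h, ← C_eq_natCast, this, C_0]

theorem two_eq_zero_of_card_eq_four (F : Type*) [Field F] [Fintype F]
    (h : Fintype.card F = 4) : (2 : F) = 0 := by
  have := FiniteField.cast_card_eq_zero F
  rw [h] at this
  have h4 : (2 : F) * 2 = 0 := by push_cast at this; linear_combination this
  simpa using h4

theorem no_large_X_add_C (a : F) :
    ¬ ∃ P : F[X], IsLargeZsigmondyPrime 1 (X + C a) P := by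
  refine not_exists_isLargeZsigmondyPrime (monic_X_add_C a) (by rw [degree_X_add_C]; norm_num)
    [] (by simp) ?_
  rw [carlitz_X_add_C_apply]
  simp

theorem no_large_self (h : Fintype.card F = 3) (a : F) :
    ¬ ∃ P : F[X], IsLargeZsigmondyPrime (X + C a) (X + C a) P := by
  refine not_exists_isLargeZsigmondyPrime (monic_X_add_C a) (by rw [degree_X_add_C]; norm_num)
    [1, 1] (by simp [degree_X_add_C]) ?_
  rw [carlitz_X_add_C_apply, h]
  simp only [List.map_cons, List.map_nil, List.prod_cons, List.prod_nil, map_one,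
    Module.End.one_apply]
  exact ⟨1, by ring⟩

theorem carlitz_X_add_C_mul_one (a b : F) :
    carlitz F ((X + C a) * (X + C b)) 1 =
      (X + C a) * (X + C b + 1) + (X + C b + 1) ^ Fintype.card F := by
  rw [carlitz_mul_apply, carlitz_X_add_C_apply b, carlitz_X_add_C_apply]
  simp

theorem no_large_consecutive (h : Fintype.card F = 3 ∨ Fintype.card F = 4 ∨ Fintype.card F = 5)
    (a : F) :
    ¬ ∃ P : F[X], IsLargeZsigmondyPrime 1 ((X + C a) * (X + C (a - 1))) P := by
  have hd := degree_X_add_C_mul a (a - 1)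
  have h1 : (1 : WithBot ℕ) < ((X + C a) * (X + C (a - 1))).degree := by
    rw [hd]; norm_num
  refine not_exists_isLargeZsigmondyPrime ((monic_X_add_C a).mul (monic_X_add_C _))
    (by rw [hd]; norm_num)
    [X + C (a - 1), X + C (a - 1), X + C a, X + C a] ?_ ?_
  · simp only [List.mem_cons, List.not_mem_nil, or_false]
    rintro n (rfl | rfl | rfl | rfl) <;> exact X_add_C_degree_cond h1 _
  · rw [carlitz_X_add_C_mul_one]
    simp only [List.map_cons, List.map_nil, List.prod_cons, List.prod_nil,
      carlitz_X_add_C_apply]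
    simp only [C_sub, C_1]
    set P : F[X] := X + C a
    have hP : X + (C a - 1) = P - 1 := by simp only [P]; ring
    rw [hP]
    rcases h with h | h | h
    · rw [h]
      exact ⟨(P * (P - 1) + 1) * (P + 1), by ring⟩
    · have h2 : (2 : F[X]) = 0 := by
        rw [← C_ofNat, two_eq_zero_of_card_eq_four F h, C_0]
      rw [h]
      exact ⟨P * (P - 1) + 1, by linear_combination P ^ 3 * (P * (P - 1) + 1) * h2⟩
    · rw [h]
      exact ⟨P + 1, by ring⟩

theorem no_large_sub_one_mul_sq (h : Fintype.card F = 3) (a : F) :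
    ¬ ∃ P : F[X], IsLargeZsigmondyPrime 1 ((X + C (a - 1)) * (X + C a) ^ 2) P := by
  have h3 : (3 : F[X]) = 0 := by exact_mod_cast card_cast_eq_zero F h
  have hd : ((X + C (a - 1)) * (X + C a) ^ 2).degree = 3 := by
    rw [pow_two, degree_mul, degree_X_add_C_mul, degree_X_add_C]; rfl
  refine not_exists_isLargeZsigmondyPrime ((monic_X_add_C _).mul ((monic_X_add_C _).pow 2))
    (by rw [hd]; norm_num)
    [X + C (a - 1), X + C (a - 1), X + C (a - 1), (X + C a) * (X + C a)] ?_ ?_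
  · simp only [List.mem_cons, List.not_mem_nil, or_false]
    have h1 := X_add_C_degree_cond (m := (X + C (a - 1)) * (X + C a) ^ 2)
      (by rw [hd]; norm_num) (a - 1)
    rintro n (rfl | rfl | rfl | rfl)
    · exact h1
    · exact h1
    · exact h1
    · refine ⟨mul_ne_zero (X_add_C_ne_zero a) (X_add_C_ne_zero a), ?_⟩
      rw [hd, degree_X_add_C_mul]; norm_num
  · have hm : (X + C (a - 1)) * (X + C a) ^ 2 =
        (X + C a) * ((X + C a) * (X + C (a - 1))) := by ring
    rw [hm, carlitz_mul_apply, carlitz_X_add_C_mul_one]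
    simp only [List.map_cons, List.map_nil, List.prod_cons, List.prod_nil,
      carlitz_X_add_C_mul_one, carlitz_X_add_C_apply, h]
    simp only [C_sub, C_1]
    set P : F[X] := X + C a
    have hP : X + (C a - 1) = P - 1 := by simp only [P]; ring
    rw [hP]
    exact ⟨1, by linear_combination (P ^ 4 + P ^ 5 - P ^ 6 - P ^ 7) * h3⟩

theorem no_large_sq (h : Fintype.card F = 3) (a : F) :
    ¬ ∃ P : F[X], IsLargeZsigmondyPrime 1 ((X + C a) ^ 2) P := by
  have h3 : (3 : F[X]) = 0 := by exact_mod_cast card_cast_eq_zero F h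
  have hd := degree_X_add_C_mul a a
  rw [pow_two]
  refine not_exists_isLargeZsigmondyPrime ((monic_X_add_C a).mul (monic_X_add_C a))
    (by rw [hd]; norm_num) [X + C a] ?_ ?_
  · simp only [List.mem_cons, List.not_mem_nil, or_false]
    rintro n rfl
    exact X_add_C_degree_cond (by rw [hd]; norm_num) _
  · rw [carlitz_X_add_C_mul_one]
    simp only [List.map_cons, List.map_nil, List.prod_cons, List.prod_nil,
      carlitz_X_add_C_apply, h]
    set P : F[X] := X + C a
    exact ⟨1, by linear_combination (-(P + 1) * P) * h3⟩

theorem no_large_card_four (h : Fintype.card F = 4) {a b : F}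
    (hab : (b - a) ^ 2 + (b - a) + 1 = 0) :
    ¬ ∃ P : F[X], IsLargeZsigmondyPrime 1 ((X + C a) * (X + C b)) P := by
  have h2 : (2 : F[X]) = 0 := by
    rw [← C_ofNat, two_eq_zero_of_card_eq_four F h, C_0]
  have hd := degree_X_add_C_mul a b
  refine not_exists_isLargeZsigmondyPrime ((monic_X_add_C a).mul (monic_X_add_C b))
    (by rw [hd]; norm_num) [X + C a, X + C b] ?_ ?_
  · simp only [List.mem_cons, List.not_mem_nil, or_false]
    have h1 : (1 : WithBot ℕ) < ((X + C a) * (X + C b)).degree := by rw [hd]; norm_num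
    rintro n (rfl | rfl) <;> exact X_add_C_degree_cond h1 _
  · rw [carlitz_X_add_C_mul_one]
    simp only [List.map_cons, List.map_nil, List.prod_cons, List.prod_nil,
      carlitz_X_add_C_apply, h]
    set P : F[X] := X + C a
    set d : F[X] := C (b - a)
    have hb : X + C b = P + d := by simp only [P, d, C_sub]; ring
    have hd0 : d ^ 2 + d + 1 = 0 := by
      simp only [d, ← C_pow, ← C_add, ← C_1, hab, C_0]
    rw [hb]
    exact ⟨1, by linear_combination (-2 - 3 * d - d ^ 2 - 7 * P - 4 * P * d - 5 * P ^ 2) * hd0 +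
      (1 + d + 2 * P - 2 * P ^ 2 * d - P ^ 3 - P ^ 3 * d) * h2⟩

/-- Here `m = T (T + 1) (T + 2)` and `C_m(1) = (m + 1) * m ^ 2`, where `T`, `T + 1` and `T + 2`
are the values at `1` of `C_{T + 2}`, `C_T` and `C_{T + 1}`. -/
theorem no_large_cube_add (h : Fintype.card F = 3) :
    ¬ ∃ P : F[X], IsLargeZsigmondyPrime 1 (X ^ 3 + 2 * X : F[X]) P := by
  have h3 : (3 : F[X]) = 0 := by exact_mod_cast card_cast_eq_zero F h
  have hm : (X ^ 3 + 2 * X : F[X]) = (X + C 0) * ((X + C 1) * (X + C 2)) := by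
    simp only [C_0, C_1, C_ofNat]
    linear_combination (-X ^ 2) * h3
  have hd : ((X + C 0) * ((X + C 1) * (X + C 2)) : F[X]).degree = 3 := by
    rw [degree_mul, degree_X_add_C_mul, degree_X_add_C]; rfl
  rw [hm]
  refine not_exists_isLargeZsigmondyPrime
    ((monic_X_add_C _).mul ((monic_X_add_C _).mul (monic_X_add_C _)))
    (by rw [hd]; norm_num) [X + C 0, X + C 0, X + C 1, X + C 1, X + C 2, X + C 2] ?_ ?_
  · have h1 (a : F) := X_add_C_degree_cond (m := (X + C 0) * ((X + C 1) * (X + C 2)))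
      (by rw [hd]; norm_num) a
    simp only [List.mem_cons, List.not_mem_nil, or_false]
    rintro n (rfl | rfl | rfl | rfl | rfl | rfl) <;> exact h1 _
  · rw [carlitz_mul_apply, carlitz_X_add_C_mul_one]
    simp only [List.map_cons, List.map_nil, List.prod_cons, List.prod_nil,
      carlitz_X_add_C_apply, h]
    simp only [C_0, C_1, C_ofNat]
    exact ⟨1, by linear_combination (-8988 - 27842 * X - 37652 * X ^ 2 - 29113 * X ^ 3 -
      14118 * X ^ 4 - 4410 * X ^ 5 - 869 * X ^ 6 - 99 * X ^ 7 - 5 * X ^ 8) * h3⟩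

end Exceptions

section Main

variable {F : Type*} [Field F] [Fintype F]

theorem not_exists_of_isFeitException {u m : F[X]} (h : IsFeitException u m) :
    ¬ ∃ P : F[X], IsLargeZsigmondyPrime u m P := by
  rcases h with ⟨hF, rfl, P, hP, -, hd, rfl⟩ | ⟨hF, rfl, P, hP, -, hd, rfl⟩ | ⟨hF, rfl, h⟩ |
    ⟨hF, rfl, h⟩ | ⟨hF, rfl, h⟩ | ⟨rfl, hm, -, hd⟩ | ⟨hF, rfl, h⟩ | ⟨hF, rfl, w, hw, h⟩ |
    ⟨hF, rfl, rfl⟩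
  · obtain ⟨a, rfl⟩ := hP.exists_eq_X_add_C (natDegree_eq_of_degree_eq_some (n := 1) hd)
    rw [X_add_C_sub_one, mul_comm]
    exact no_large_consecutive (.inl hF) a
  · obtain ⟨a, rfl⟩ := hP.exists_eq_X_add_C (natDegree_eq_of_degree_eq_some (n := 1) hd)
    rw [X_add_C_sub_one, mul_comm]
    exact no_large_consecutive (.inr (.inl hF)) a
  · rcases h with rfl | rfl | rfl
    · simpa [sub_eq_add_neg] using no_large_sub_one_mul_sq hF (0 : F)
    · simpa using no_large_sub_one_mul_sq hF (1 : F)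
    · have := no_large_sub_one_mul_sq hF (2 : F)
      rwa [show (2 : F) - 1 = 1 by norm_num, C_1, C_ofNat] at this
  · rcases h with rfl | rfl | rfl
    · simpa using no_large_self hF (0 : F)
    · simpa using no_large_self hF (1 : F)
    · simpa [C_ofNat] using no_large_self hF (2 : F)
  · have h5 : (5 : F) = 0 := by
      have := FiniteField.cast_card_eq_zero F
      rw [hF] at this
      exact_mod_cast this
    have key (a b : F) (hab : a = b - 1) :
        ¬ ∃ P : F[X], IsLargeZsigmondyPrime 1 ((X + C a) * (X + C b)) P := by
      rw [hab, mul_comm]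
      exact no_large_consecutive (.inr (.inr hF)) b
    rcases h with rfl | rfl | rfl | rfl | rfl
    · simpa [C_ofNat] using key 0 1 (by ring)
    · simpa [C_ofNat] using key 1 2 (by ring)
    · simpa [C_ofNat] using key 2 3 (by ring)
    · simpa [C_ofNat] using key 3 4 (by ring)
    · simpa [C_ofNat] using key 4 0 (by linear_combination h5)
  · obtain ⟨a, rfl⟩ := hm.exists_eq_X_add_C (natDegree_eq_of_degree_eq_some (n := 1) hd)
    exact no_large_X_add_C a
  · rcases h with rfl | rfl | rfl
    · simpa using no_large_sq hF (0 : F)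
    · simpa using no_large_sq hF (1 : F)
    · simpa [C_ofNat] using no_large_sq hF (2 : F)
  · have h2 := two_eq_zero_of_card_eq_four F hF
    rcases h with rfl | rfl | rfl | rfl
    · have := no_large_card_four hF (a := 0) (b := w) (by linear_combination hw)
      rwa [C_0, add_zero] at this
    · have := no_large_card_four hF (a := 0) (b := w ^ 2)
        (by linear_combination (w ^ 2 - w + 1) * hw)
      rwa [C_0, add_zero] at this
    · have := no_large_card_four hF (a := 1) (b := w) (by linear_combination hw - w * h2)
      rwa [C_1] at this
    · have := no_large_card_four hF (a := 1) (b := w ^ 2)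
        (by linear_combination (w ^ 2 - w - 1) * hw + (w + 1) * h2)
      rwa [C_1] at this
  · exact no_large_cube_add hF

end Main

/-! ### Pairs without large Zsigmondy primes are exceptional -/

section Main

variable {F : Type*} [Field F]

theorem irreducible_or_exists_X_add_C_mul {m : F[X]} (hm : m.Monic) (h2 : 2 ≤ m.natDegree)
    (h3 : m.natDegree ≤ 3) :
    Irreducible m ∨ ∃ (a : F) (m₂ : F[X]), m₂.Monic ∧ m₂.natDegree + 1 = m.natDegree ∧
      m = (X + C a) * m₂ := by
  by_cases hi : Irreducible m
  · exact .inl hi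
  right
  rw [hm.irreducible_iff_roots_eq_zero_of_degree_le_three h2 h3] at hi
  obtain ⟨r, hr⟩ := Multiset.exists_mem_of_ne_zero hi
  obtain ⟨m₂, hm₂⟩ := dvd_iff_isRoot.2 (mem_roots'.1 hr).2
  have hX : X - C r = X + C (-r) := by rw [C_neg, sub_eq_add_neg]
  rw [hX] at hm₂
  have hm₂m : m₂.Monic := (monic_X_add_C (-r)).of_mul_monic_left (hm₂ ▸ hm)
  refine ⟨-r, m₂, hm₂m, ?_, hm₂⟩
  rw [hm₂, (monic_X_add_C (-r)).natDegree_mul hm₂m, natDegree_X_add_C, add_comm]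

theorem prime_X_add_C (a : F) : Prime (X + C a : F[X]) :=
  (irreducible_of_degree_eq_one (degree_X_add_C a)).prime

variable [Fintype F]

theorem cast_of_card_eq {n : ℕ} (h : Fintype.card F = n) : (n : F) = 0 := by
  rw [← h, FiniteField.cast_card_eq_zero]

theorem eq_of_card_eq_three (h : Fintype.card F = 3) (a : F) : a = 0 ∨ a = 1 ∨ a = 2 := by
  have h3 : (3 : F) = 0 := by exact_mod_cast cast_of_card_eq h
  have ha : a ^ 3 = a := by simpa [h] using FiniteField.pow_card a
  have : a * ((a - 1) * (a - 2)) = 0 := by linear_combination ha + (a - a ^ 2) * h3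
  simpa [sub_eq_zero] using this

theorem eq_of_card_eq_four (h : Fintype.card F = 4) (a : F) :
    a = 0 ∨ a = 1 ∨ a ^ 2 + a + 1 = 0 := by
  have ha : a ^ 4 = a := by simpa [h] using FiniteField.pow_card a
  have : a * ((a - 1) * (a ^ 2 + a + 1)) = 0 := by linear_combination ha
  simpa [sub_eq_zero] using this

theorem eq_of_card_eq_five (h : Fintype.card F = 5) (a : F) :
    a = 0 ∨ a = 1 ∨ a = 2 ∨ a = 3 ∨ a = 4 := by
  have h5 : (5 : F) = 0 := by exact_mod_cast cast_of_card_eq h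
  have ha : a ^ 5 = a := by simpa [h] using FiniteField.pow_card a
  have : a * ((a - 1) * ((a - 2) * ((a - 3) * (a - 4)))) = 0 := by
    linear_combination ha + (-2 * a ^ 4 + 7 * a ^ 3 - 10 * a ^ 2 + 5 * a) * h5
  simpa [sub_eq_zero] using this

/-- For `u = 1` the order of `u` modulo an intrinsic prime is not constant, and has degree at most
that of the prime. -/
theorem IsIntrinsicPrime.exists_of_one {m P : F[X]} (hP : P.Monic) (hPp : Prime P)
    (h : IsIntrinsicPrime 1 m P) :
    ∃ (m₀ : F[X]) (k : ℕ), m₀.Monic ∧ m = m₀ * P ^ (k + 1) ∧ m₀ ∣ P - 1 ∧ 1 ≤ m₀.natDegree ∧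
      m₀.natDegree ≤ P.natDegree ∧ (m₀.natDegree = P.natDegree → m₀ = P - 1) ∧
      m.natDegree = m₀.natDegree + (k + 1) * P.natDegree := by
  obtain ⟨m₀, k, hm₀, hk, hm, hdvd, hPm⟩ := h
  obtain ⟨j, rfl⟩ := Nat.exists_eq_succ_of_ne_zero hk
  have hP1 : (P - 1).Monic := hP.sub_of_left (by
    rw [degree_one]; exact degree_pos_of_irreducible hPp.irreducible)
  have hP1d : (P - 1).natDegree = P.natDegree := by
    simpa using natDegree_sub_C (p := P) (a := 1)
  refine ⟨m₀, j, hm₀, hm, hdvd, ?_, ?_, fun he ↦ ?_, ?_⟩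
  · by_contra h0
    have h1 : m₀ = 1 := hm₀.natDegree_eq_zero.1 (by omega)
    rw [h1, map_one (carlitz F), Module.End.one_apply] at hPm
    exact hPp.not_isUnit (isUnit_of_dvd_one hPm)
  · exact hP1d ▸ natDegree_le_of_dvd hdvd hP1.ne_zero
  · exact (eq_of_monic_of_dvd_of_natDegree_le hm₀ hP1 hdvd (by omega)).symm
  · rw [hm, hm₀.natDegree_mul (hP.pow _), hP.natDegree_pow]

theorem two_mul_lt_three_pow {n : ℕ} (hn : 1 ≤ n) : 2 * n < 3 ^ n := by
  induction n, hn using Nat.le_induction with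
  | base => norm_num
  | succ n hn ih => rw [pow_succ]; omega

theorem two_mul_lt_two_pow {n : ℕ} (hn : 3 ≤ n) : 2 * n < 2 ^ n := by
  induction n, hn using Nat.le_induction with
  | base => norm_num
  | succ n hn ih => rw [pow_succ]; omega

theorem six_mul_lt_two_pow {n : ℕ} (hn : 5 ≤ n) : 6 * n + 1 < 2 ^ n := by
  induction n, hn using Nat.le_induction with
  | base => norm_num
  | succ n hn ih => rw [pow_succ]; omega

theorem mul_lt_pow_of_three_le {r n : ℕ} (hr : 3 ≤ r) (hn : 3 ≤ n) :
    (r + 1) * (n + n) + 1 < r ^ n := by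
  induction n, hn using Nat.le_induction with
  | base => nlinarith [Nat.mul_le_mul hr hr]
  | succ n hn ih =>
    rw [pow_succ]
    have h1 : r ^ n * 3 ≤ r ^ n * r := Nat.mul_le_mul_left _ hr
    nlinarith

/-- For `u` of positive degree, `(q - 1) ^ deg m ≤ 2 * deg m` forces `q = 3` and `deg m ≤ 2`. If
`deg m = 2`, then equality holds throughout and `m = P * Q` with both primes intrinsic, so that
`Q = P - 1` and `P = Q - 1`, which is impossible in characteristic three. -/
theorem exception_of_natDegree_pos (hq : 2 < Fintype.card F) {u m m' : F[X]} {s : Finset F[X]}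
    (hu : u.Monic) (h : IsRadicalDecomposition m m' s) (hud : 1 ≤ u.natDegree)
    (hno : ¬ ∃ P : F[X], IsLargeZsigmondyPrime u m P) : IsFeitException u m := by
  obtain ⟨B, hB, hBm, hint, e, he, -, hbound, -⟩ := totient_bound hq hu h hno
  have hm := h.monic_self
  have hφ := h.pow_natDegree_le_totient hq
  have hb : B.natDegree ≤ m.natDegree := natDegree_le_of_dvd hBm hm.ne_zero
  have hbd := hbound hud
  have hφu : polyTotient m' s ≤ polyTotient m' s * u.natDegree := Nat.le_mul_of_pos_right _ hud
  have hn : 1 ≤ m.natDegree := by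
    by_contra h0
    have h1 : m.natDegree = 0 := by omega
    rw [h1, pow_zero] at hφ
    omega
  have hq3 : Fintype.card F = 3 := by
    by_contra h3
    have h1 : 3 ^ m.natDegree ≤ (Fintype.card F - 1) ^ m.natDegree :=
      Nat.pow_le_pow_left (by omega) _
    have := two_mul_lt_three_pow hn
    omega
  have hn2 : m.natDegree ≤ 2 := by
    by_contra h3
    rw [hq3] at hφ
    have := two_mul_lt_two_pow (n := m.natDegree) (by omega)
    norm_num at hφ
    omega
  have hbn : B.natDegree = m.natDegree := by
    rw [hq3] at hφ
    interval_cases h1 : m.natDegree <;> norm_num at hφ <;> omega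
  have hBeq : B = m := (eq_of_monic_of_dvd_of_natDegree_le hB hm hBm hbn.ge).symm
  subst hBeq
  rcases (by omega : B.natDegree = 1 ∨ B.natDegree = 2) with h1 | h2
  · rw [hq3, h1] at hφ
    norm_num at hφ
    obtain ⟨a, rfl⟩ := hm.exists_eq_X_add_C h1
    obtain ⟨m₀, k, hm₀, hk, hmk, -, hdvd⟩ := hint _ hm (prime_X_add_C a) dvd_rfl
    have hd := congrArg natDegree hmk
    rw [hm₀.natDegree_mul (hm.pow _), hm.natDegree_pow, natDegree_X_add_C] at hd
    rw [hm₀.natDegree_eq_zero.1 (by omega), map_one, Module.End.one_apply] at hdvd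
    have hu1 : u.natDegree = 1 := by
      have : u.natDegree < 2 := by
        by_contra hge
        have := Nat.mul_le_mul hφ (not_lt.1 hge)
        omega
      omega
    have hum := eq_of_monic_of_dvd_of_natDegree_le hm hu hdvd (by rw [hu1, natDegree_X_add_C])
    refine .inr (.inr (.inr (.inl ⟨hq3, hum, ?_⟩)))
    rcases eq_of_card_eq_three hq3 a with rfl | rfl | rfl
    · simp
    · simp
    · simp [C_ofNat]
  · exfalso
    have hstep {P : F[X]} (hP : P.Monic) (hPp : Prime P) (hPB : P ∣ B) :
        ∃ m₀ : F[X], m₀.Monic ∧ m₀.natDegree = 1 ∧ B = m₀ * P ∧ m₀ ∣ P - 1 := by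
      obtain ⟨m₀, k, hm₀, hk, hmk, hdvd, -⟩ := hint P hP hPp hPB
      obtain ⟨j, rfl⟩ := Nat.exists_eq_succ_of_ne_zero hk
      have hle := h.mul_pow_le_totient hq hm₀ hP hPp hmk
      have hd := congrArg natDegree hmk
      have hPd := hPp.irreducible.natDegree_pos
      rw [hm₀.natDegree_mul (hP.pow _), hP.natDegree_pow, h2, Nat.succ_eq_add_one] at hd
      have hle4 := hle.trans (hφu.trans (hbd.trans (by omega : _ ≤ 4)))
      rw [hq3] at hle4
      have hj : j ≤ 1 := by nlinarith
      have hP2 : P.natDegree ≤ 2 := by nlinarith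
      refine ⟨m₀, hm₀, ?_, ?_, hdvd⟩
      · interval_cases j <;> interval_cases P.natDegree <;> try omega
        all_goals
          rw [(by omega : m₀.natDegree = 0)] at hle4
          norm_num at hle4
      · interval_cases j
        · simpa using hmk
        · have hP1 : P.natDegree = 1 := by omega
          have h0 : m₀.natDegree = 0 := by omega
          rw [hP1, h0] at hle4
          norm_num at hle4
    obtain ⟨P, hP, hPp, hPB⟩ := exists_monic_prime_dvd hm.ne_zero
      (not_isUnit_of_natDegree_pos _ (by omega))
    obtain ⟨m₀, hm₀, hd₀, hBe, hdvd⟩ := hstep hP hPp hPB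
    have hPd : P.natDegree = 1 := by
      have hd := congrArg natDegree hBe
      rw [hm₀.natDegree_mul hP] at hd
      omega
    obtain ⟨a, rfl⟩ := hP.exists_eq_X_add_C hPd
    obtain ⟨b, rfl⟩ := hm₀.exists_eq_X_add_C hd₀
    obtain ⟨m₁, hm₁, hd₁, hBe₁, hdvd₁⟩ := hstep hm₀ (prime_X_add_C b) (hBe ▸ dvd_mul_right _ _)
    have hm₁a : m₁ = X + C a := by
      rw [hBe, mul_comm] at hBe₁
      exact (mul_right_cancel₀ (X_add_C_ne_zero b) hBe₁).symm
    subst hm₁a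
    have e1 := eq_of_monic_of_dvd_of_natDegree_le hm₀
      (by rw [X_add_C_sub_one]; exact monic_X_add_C _) hdvd
      (by rw [X_add_C_sub_one, natDegree_X_add_C, natDegree_X_add_C])
    have e2 := eq_of_monic_of_dvd_of_natDegree_le hP
      (by rw [X_add_C_sub_one]; exact monic_X_add_C _) hdvd₁
      (by rw [X_add_C_sub_one, natDegree_X_add_C, natDegree_X_add_C])
    have h20 : (2 : F[X]) = 0 := by linear_combination -e1 - e2
    have h30 : (3 : F[X]) = 0 := by exact_mod_cast card_cast_eq_zero F hq3
    exact one_ne_zero (α := F[X]) (by linear_combination h30 - h20)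

theorem isFeitException_consecutive (hq : Fintype.card F = 3 ∨ Fintype.card F = 4 ∨
    Fintype.card F = 5) (a : F) : IsFeitException 1 ((X + C a - 1) * (X + C a)) := by
  rcases hq with h | h | h
  · exact .inl ⟨h, rfl, _, monic_X_add_C a, prime_X_add_C a, degree_X_add_C a, rfl⟩
  · exact .inr (.inl ⟨h, rfl, _, monic_X_add_C a, prime_X_add_C a, degree_X_add_C a, rfl⟩)
  · have h5 : (5 : F[X]) = 0 := by exact_mod_cast card_cast_eq_zero F h
    refine .inr (.inr (.inr (.inr (.inl ⟨h, rfl, ?_⟩))))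
    rcases eq_of_card_eq_five h a with rfl | rfl | rfl | rfl | rfl
    · right; right; right; right
      rw [C_0]
      linear_combination (-X) * h5
    · left
      rw [C_1]; ring
    · right; left
      rw [C_ofNat]; ring
    · right; right; left
      rw [C_ofNat]; ring
    · right; right; right; left
      rw [C_ofNat]; ring

/-- In degree two an intrinsic prime `P` forces `m = (P - 1) * P` and `q ≤ 5`; without one,
`φ(m) ≤ 2 * q + 1`. -/
theorem exception_of_natDegree_eq_two (hq : 2 < Fintype.card F) {m m' : F[X]} {s : Finset F[X]}
    (h : IsRadicalDecomposition m m' s) (hn : m.natDegree = 2)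
    (hno : ¬ ∃ P : F[X], IsLargeZsigmondyPrime 1 m P) : IsFeitException 1 m := by
  obtain ⟨B, hB, hBm, hint, e, he, -, -, hbound⟩ := totient_bound hq monic_one h hno
  have hm := h.monic_self
  have hφ := h.pow_natDegree_le_totient hq
  have hb : B.natDegree ≤ m.natDegree := natDegree_le_of_dvd hBm hm.ne_zero
  have hbd := hbound rfl
  rw [hn] at hφ he hb
  obtain ⟨r, hr⟩ : ∃ r, Fintype.card F = r + 1 := ⟨_, (Nat.sub_add_cancel (by omega)).symm⟩
  by_cases hBu : IsUnit B
  swap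
  · obtain ⟨P, hP, hPp, hPB⟩ := exists_monic_prime_dvd hB.ne_zero hBu
    obtain ⟨m₀, k, hm₀, hmk, -, hd1, hd2, hd3, hd⟩ :=
      (hint P hP hPp hPB).exists_of_one hP hPp
    have hk : k = 0 := by nlinarith
    subst hk
    have hPd : P.natDegree = 1 := by omega
    rw [hd3 (by omega), zero_add, pow_one] at hmk
    obtain ⟨a, rfl⟩ := hP.exists_eq_X_add_C hPd
    rw [hmk]
    apply isFeitException_consecutive
    -- the inequalities alone allow `q = 6`
    have h6 : Fintype.card F ≠ 6 := fun h6 ↦ by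
      have := FiniteField.isPrimePow_card F
      rw [h6] at this
      exact absurd this (by decide)
    have : Fintype.card F ≤ 6 := by
      rw [hr] at hbd hφ ⊢
      rw [Nat.add_sub_cancel] at hφ
      have : (r + 1) * (e + B.natDegree) ≤ (r + 1) * 4 := Nat.mul_le_mul_left _ (by omega)
      by_contra hlt
      nlinarith
    omega
  · have hb0 : B.natDegree = 0 := by rw [hB.eq_one_of_isUnit hBu, natDegree_one]
    have hbd2 : polyTotient m' s ≤ (r + 1) * 2 + 1 := by
      rw [hb0, add_zero, hr] at hbd
      exact hbd.trans (by gcongr)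
    rcases irreducible_or_exists_X_add_C_mul hm hn.ge (by omega) with hi | ⟨a, m₂, hm₂, hd₂, hmm⟩
    · exfalso
      have := h.mul_pow_le_totient hq monic_one hm hi.prime (k := 0) (by ring)
      rw [hn, hr] at this
      simp only [mul_zero, pow_zero, mul_one, natDegree_one] at this
      have h1 : (r + 1) ^ 2 ≤ (r + 1) * 2 + 2 := by omega
      nlinarith
    · obtain ⟨b, rfl⟩ := hm₂.exists_eq_X_add_C (by omega)
      by_cases hab : a = b
      · subst hab
        have := h.mul_pow_le_totient hq monic_one (monic_X_add_C a) (prime_X_add_C a) (k := 1)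
          (by rw [hmm]; ring)
        rw [natDegree_X_add_C, hr] at this
        simp only [mul_one, pow_one, natDegree_one, pow_zero, Nat.add_sub_cancel] at this
        have hr2 : r = 2 := by
          have : r < 3 := by nlinarith
          omega
        subst hr2
        refine .inr (.inr (.inr (.inr (.inr (.inr (.inl ⟨hr, rfl, ?_⟩))))))
        rw [hmm, ← pow_two]
        rcases eq_of_card_eq_three hr a with rfl | rfl | rfl
        · simp
        · simp
        · simp [C_ofNat]
      · have hr4 : r < 4 := by
          rw [hr, Nat.add_sub_cancel] at hφ
          by_contra h4
          nlinarith
        have hcons {a b : F} (h1 : b - a = 1) (h34 : r = 2 ∨ r = 3) :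
            IsFeitException 1 ((X + C a) * (X + C b)) := by
          have : (X + C a : F[X]) = X + C b - 1 := by
            rw [X_add_C_sub_one, ← h1]; simp
          rw [this]
          exact isFeitException_consecutive (by omega) b
        rw [hmm]
        rcases (by omega : r = 2 ∨ r = 3) with rfl | rfl
        · rcases eq_of_card_eq_three hr (b - a) with h1 | h1 | h1
          · exact absurd (sub_eq_zero.1 h1).symm hab
          · exact hcons h1 (.inl rfl)
          · have h3 : (3 : F) = 0 := by exact_mod_cast cast_of_card_eq hr
            rw [mul_comm]
            exact hcons (by linear_combination -h1 - h3) (.inl rfl)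
        · rcases eq_of_card_eq_four hr (b - a) with h1 | h1 | h1
          · exact absurd (sub_eq_zero.1 h1).symm hab
          · exact hcons h1 (.inr rfl)
          · have h2 := two_eq_zero_of_card_eq_four F hr
            refine .inr (.inr (.inr (.inr (.inr (.inr (.inr (.inl ⟨hr, rfl, b - a, h1, ?_⟩)))))))
            rcases eq_of_card_eq_four hr a with h0 | h0 | h0
            · left
              simp [h0]
            · right; right; right
              have : b = (b - a) ^ 2 := by
                linear_combination -h1 + b * h2 - h0
              rw [← this, h0, C_1]
            · have : (a - (b - a)) * (a - (b - a) ^ 2) = 0 := by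
                linear_combination h0 - (a + 1 - (b - a)) * h1
              rcases mul_eq_zero.1 this with h' | h'
              · have hb0 : b = 0 := by linear_combination -h' + a * h2
                have hw : b - a = a := by linear_combination -h'
                left
                rw [hw, hb0, C_0, add_zero, mul_comm]
              · have hb1 : b = 1 := by linear_combination h1 + h' - h2
                right; right; right
                rw [← sub_eq_zero.1 h', hb1, C_1, mul_comm]

/-- In degree three over `𝔽₃` an intrinsic prime `P` forces `m = (P - 1) * P ^ 2`, or `m = Q * P`
with `P` a quadratic and `Q` a linear divisor of `P - 1`; without one, `φ(m) ≤ 10`, so that `m` is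
the product of the three linear polynomials. -/
theorem exception_of_natDegree_eq_three (hF : Fintype.card F = 3) {m m' : F[X]} {s : Finset F[X]}
    (h : IsRadicalDecomposition m m' s) (hn : m.natDegree = 3)
    (hno : ¬ ∃ P : F[X], IsLargeZsigmondyPrime 1 m P) : IsFeitException 1 m := by
  have hq : 2 < Fintype.card F := by omega
  have h3 : (3 : F) = 0 := by exact_mod_cast cast_of_card_eq hF
  have h3X : (3 : F[X]) = 0 := by exact_mod_cast card_cast_eq_zero F hF
  obtain ⟨B, hB, hBm, hint, e, he, he0, -, hbound⟩ := totient_bound hq monic_one h hno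
  have hm := h.monic_self
  have hb : B.natDegree ≤ m.natDegree := natDegree_le_of_dvd hBm hm.ne_zero
  have hbd := hbound rfl
  rw [hn] at he hb
  rw [hF] at hbd
  by_cases hBu : IsUnit B
  swap
  · obtain ⟨P, hP, hPp, hPB⟩ := exists_monic_prime_dvd hB.ne_zero hBu
    obtain ⟨m₀, k, hm₀, hmk, hdvd, hd1, hd2, hd3, hd⟩ :=
      (hint P hP hPp hPB).exists_of_one hP hPp
    have hle := h.mul_pow_le_totient hq hm₀ hP hPp hmk
    have hk : k ≤ 1 := by nlinarith
    interval_cases k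
    · -- an irreducible quadratic `P` times a linear factor of `P - 1`; here `m + 1` has a root
      exfalso
      have hPd : P.natDegree = 2 := by omega
      have hd0 : m₀.natDegree = 1 := by omega
      rw [hF, hPd, hd0] at hle
      norm_num at hle
      obtain ⟨a, rfl⟩ := hm₀.exists_eq_X_add_C hd0
      obtain ⟨l, hl⟩ := hdvd
      have hP1 : (P - 1).Monic := hP.sub_of_left (by
        rw [degree_one]; exact degree_pos_of_irreducible hPp.irreducible)
      have hlm : l.Monic := hm₀.of_mul_monic_left (hl ▸ hP1)
      have hld : l.natDegree = 1 := by
        have h1 := congrArg natDegree hl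
        rw [hm₀.natDegree_mul hlm, natDegree_X_add_C] at h1
        have h2 : (P - 1).natDegree = P.natDegree := by
          simpa using natDegree_sub_C (p := P) (a := 1)
        omega
      obtain ⟨b, rfl⟩ := hlm.exists_eq_X_add_C hld
      have hPe : P = (X + C a) * (X + C b) + 1 := by linear_combination hl
      have hroot (x : F) : eval x P ≠ 0 := fun h0 ↦ by
        have h1 := degree_eq_one_of_irreducible_of_root hPp.irreducible h0
        rw [natDegree_eq_of_degree_eq_some (n := 1) h1] at hPd
        omega
      -- `P` has no root, which leaves `P = (X + a) ^ 2 + 1`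
      have hab : b = a := by
        have h1 := hroot (1 - a)
        have h2 := hroot (2 - a)
        simp only [hPe, eval_add, eval_mul, eval_X, eval_C, eval_one] at h1 h2
        rcases eq_of_card_eq_three hF (b - a) with h' | h' | h'
        · exact sub_eq_zero.1 h'
        · exact absurd (by linear_combination h' + h3) h1
        · exact absurd (by linear_combination 2 * h' + 3 * h3) h2
      have hnp : ¬ Prime (m + 1) := fun hp ↦ by
        have h0 : eval (1 - a) (m + 1) = 0 := by
          rw [hmk, hPe, hab]
          simp only [eval_add, eval_mul, eval_X, eval_C, eval_one, eval_pow]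
          linear_combination h3
        have h1 := degree_eq_one_of_irreducible_of_root hp.irreducible h0
        have h2 : (m + 1).natDegree = m.natDegree := by
          simpa using natDegree_add_C (p := m) (a := 1)
        rw [natDegree_eq_of_degree_eq_some (n := 1) h1] at h2
        omega
      rw [he0 hnp] at hbd
      omega
    · have hPd : P.natDegree = 1 := by omega
      rw [hd3 (by omega)] at hmk
      obtain ⟨a, rfl⟩ := hP.exists_eq_X_add_C hPd
      refine .inr (.inr (.inl ⟨hF, rfl, ?_⟩))
      rcases eq_of_card_eq_three hF a with rfl | rfl | rfl
      · left
        rw [hmk, C_0, add_zero]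
      · right; left
        rw [hmk, C_1]; ring
      · right; right
        rw [hmk, C_ofNat]; ring
  · have hb0 : B.natDegree = 0 := by rw [hB.eq_one_of_isUnit hBu, natDegree_one]
    have hbd2 : polyTotient m' s ≤ 10 := by omega
    rcases irreducible_or_exists_X_add_C_mul hm (by omega) hn.le with hi | ⟨a, m₂, hm₂, hd₂, hmm⟩
    · exfalso
      have := h.mul_pow_le_totient hq monic_one hm hi.prime (k := 0) (by ring)
      rw [hn, hF] at this
      norm_num at this
      omega
    rcases irreducible_or_exists_X_add_C_mul hm₂ (by omega) (by omega) with
      hi | ⟨b, m₃, hm₃, hd₃, hmm₂⟩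
    · exfalso
      have := h.mul_pow_le_totient hq (monic_X_add_C a) hm₂ hi.prime (k := 0) (by rw [hmm]; ring)
      rw [(by omega : m₂.natDegree = 2), hF, natDegree_X_add_C] at this
      norm_num at this
      omega
    obtain ⟨c, rfl⟩ := hm₃.exists_eq_X_add_C (by omega)
    have hne {x y : F} (hxy : m = (X + C x) * (X + C y) ^ 2) : False := by
      have := h.mul_pow_le_totient hq (monic_X_add_C x) (monic_X_add_C y) (prime_X_add_C y)
        (k := 1) hxy
      rw [hF, natDegree_X_add_C, natDegree_X_add_C] at this
      norm_num at this
      omega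
    rw [hmm₂] at hmm
    have hab : a ≠ b := by rintro rfl; exact hne (x := c) (y := a) (by rw [hmm]; ring)
    have hac : a ≠ c := by rintro rfl; exact hne (x := b) (y := a) (by rw [hmm]; ring)
    have hbc : b ≠ c := by rintro rfl; exact hne (x := a) (y := b) (by rw [hmm]; ring)
    refine .inr (.inr (.inr (.inr (.inr (.inr (.inr (.inr ⟨hF, rfl, ?_⟩)))))))
    rw [hmm]
    rcases eq_of_card_eq_three hF a with rfl | rfl | rfl <;>
    rcases eq_of_card_eq_three hF b with rfl | rfl | rfl <;>
    rcases eq_of_card_eq_three hF c with rfl | rfl | rfl <;>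
    first
      | exact absurd rfl hab
      | exact absurd rfl hac
      | exact absurd rfl hbc
      | (simp only [C_0, C_1, C_ofNat]; linear_combination X ^ 2 * h3X)

/-- For `u = 1`, the bound `(q - 1) ^ deg m ≤ 2 * q * deg m + 1` leaves only `deg m ≤ 2` for
`q > 3` and `deg m ≤ 4` for `q = 3`. -/
theorem exception_of_one (hq : 2 < Fintype.card F) {m m' : F[X]} {s : Finset F[X]}
    (h : IsRadicalDecomposition m m' s) (hn : 1 ≤ m.natDegree)
    (hno : ¬ ∃ P : F[X], IsLargeZsigmondyPrime 1 m P) : IsFeitException 1 m := by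
  have hm := h.monic_self
  rcases (by omega : m.natDegree = 1 ∨ m.natDegree = 2 ∨ 3 ≤ m.natDegree) with h1 | h2 | h3
  · obtain ⟨a, rfl⟩ := hm.exists_eq_X_add_C h1
    exact .inr (.inr (.inr (.inr (.inr (.inl ⟨rfl, hm, prime_X_add_C a, degree_X_add_C a⟩)))))
  · exact exception_of_natDegree_eq_two hq h h2 hno
  have hφ := h.pow_natDegree_le_totient hq
  obtain ⟨B, hB, hBm, hint, e, he, -, -, hbound⟩ := totient_bound hq monic_one h hno
  have hb : B.natDegree ≤ m.natDegree := natDegree_le_of_dvd hBm hm.ne_zero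
  have hbd := hbound rfl
  obtain ⟨r, hr⟩ : ∃ r, Fintype.card F = r + 1 := ⟨_, (Nat.sub_add_cancel (by omega)).symm⟩
  have hbd' : (Fintype.card F - 1) ^ m.natDegree ≤
      Fintype.card F * (m.natDegree + m.natDegree) + 1 :=
    hφ.trans (hbd.trans (by gcongr))
  have hF : Fintype.card F = 3 := by
    by_contra hne
    have := mul_lt_pow_of_three_le (r := r) (n := m.natDegree) (by omega) h3
    rw [hr, Nat.add_sub_cancel] at hbd'
    omega
  have hn4 : m.natDegree ≤ 4 := by
    by_contra hlt
    have := six_mul_lt_two_pow (n := m.natDegree) (by omega)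
    rw [hF] at hbd'
    norm_num at hbd'
    omega
  rcases (by omega : m.natDegree = 3 ∨ m.natDegree = 4) with h3' | h4
  · exact exception_of_natDegree_eq_three hF h h3' hno
  exfalso
  rw [hF, h4] at hφ
  rw [hF] at hbd
  norm_num at hφ
  -- the general bound does not exclude degree four, but an intrinsic prime makes `φ(m) ≥ 32`
  by_cases hBu : IsUnit B
  · have hb0 : B.natDegree = 0 := by rw [hB.eq_one_of_isUnit hBu, natDegree_one]
    omega
  · obtain ⟨P, hP, hPp, hPB⟩ := exists_monic_prime_dvd hB.ne_zero hBu
    obtain ⟨m₀, k, hm₀, hmk, hdvd, hd1, hd2, hd3, hd⟩ :=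
      (hint P hP hPp hPB).exists_of_one hP hPp
    have hle := h.mul_pow_le_totient hq hm₀ hP hPp hmk
    rw [hF] at hle
    have hle25 := hle.trans (hbd.trans (by omega : _ ≤ 25))
    have hk : k ≤ 2 := by nlinarith
    have hP3 : P.natDegree ≤ 3 := by nlinarith
    have hP1 : 1 ≤ P.natDegree := hPp.irreducible.natDegree_pos
    rw [h4] at hd
    interval_cases k <;> interval_cases hPd : P.natDegree <;> try omega
    · rw [(by omega : m₀.natDegree = 2)] at hle25
      norm_num at hle25
    · rw [(by omega : m₀.natDegree = 1)] at hle25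
      norm_num at hle25
    · rw [(by omega : m₀.natDegree = 1)] at hle25
      norm_num at hle25

end Main

theorem mainTheorem1 (F : Type*) [Field F] [Fintype F] (hq : 2 < Fintype.card F)
    (u m : F[X]) (hu : u.Monic) (hm : m.Monic) (hpos : 0 < u.degree ∨ 0 < m.degree) :
    (∃ P : F[X], IsLargeZsigmondyPrime u m P) ↔ ¬ IsFeitException u m := by
  refine ⟨fun h h' ↦ not_exists_of_isFeitException h' h, fun h ↦ ?_⟩
  by_contra hno
  obtain ⟨m', s, hs⟩ := exists_isRadicalDecomposition hm
  rcases Nat.eq_zero_or_pos u.natDegree with h0 | h0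
  · obtain rfl := hu.natDegree_eq_zero.1 h0
    rw [degree_one, lt_self_iff_false, false_or, ← natDegree_pos_iff_degree_pos] at hpos
    exact h (exception_of_one hq hs hpos hno)
  · exact h (exception_of_natDegree_pos hq hu hs h0 hno)
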